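/- Write $P_m$ for the path with $m$ vertices, $K_m$ for the complete graph with $m$ vertices, $\overline{K}_m$ for its complement, $tH$ for $t$ disjoint copies of $H$, $\cup$ for disjoint union, and $H_1\vee H_2$ for the join (the disjoint union together with all edges between the two graphs). All graphs are finite and simple; $H\subseteq G$ means that $G$ has a subgraph isomorphic to $H$, and equality of graphs means isomorphism. Put $S_{n,h}=K_h\vee\overline{K}_{n-h}$ and $L_{t,h}=K_1\vee tK_h$. Let $k\ge 1$, $a_1\ge\dots\ge a_k\ge 1$ and $b_1\ge 1$ be integers, let $$F=P_{2a_1}\cup\dots\cup P_{2a_k}\cup P_{2b_1+1},\qquad h=\sum_{i=1}^k a_i+b_1-1,$$ and suppose $h\ge 1$. Let $G$ be a connected graph with $n\ge 2h+3$ vertices and minimum degree $\delta(G)\ge h$. Then $F\subseteq G$, unless one of the following holds: (i) $G\subseteq S_{n,h}$; (ii) $F=P_6\cup P_3$, $n$ is even, and $G\subseteq K_2\vee\frac{n-2}{2}K_2$; (iii) $F\in\{P_{2b_1}\cup P_{2b_1+1},\ P_{2b_1+2}\cup P_{2b_1+1}\}$ and $G=L_{t,h}$ for some integer $t$ with $n=th+1$.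 -/

import Mathlib

open SimpleGraph

namespace PathForest

/-- The join `G ∨ H`: the disjoint union of `G` and `H` together with all edges between them. -/
def join {V W : Type*} (G : SimpleGraph V) (H : SimpleGraph W) : SimpleGraph (V ⊕ W) where
  Adj
    | Sum.inl u, Sum.inl v => G.Adj u v
    | Sum.inr u, Sum.inr v => H.Adj u v
    | Sum.inl _, Sum.inr _ => True
    | Sum.inr _, Sum.inl _ => True
  symm := ⟨by
    rintro (u | u) (v | v) h
    · exact G.adj_symm h
    · trivial
    · trivial
    · exact H.adj_symm h⟩
  loopless := ⟨by
    rintro (u | u) h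
    · exact G.loopless.irrefl u h
    · exact H.loopless.irrefl u h⟩

/-- The disjoint union of an indexed family of graphs. -/
def disjUnion {ι : Type*} {V : ι → Type*} (G : ∀ i, SimpleGraph (V i)) :
    SimpleGraph (Σ i, V i) where
  Adj x y := ∃ (i : ι) (u v : V i), (G i).Adj u v ∧ x = ⟨i, u⟩ ∧ y = ⟨i, v⟩
  symm := ⟨by
    rintro x y ⟨i, u, v, h, hx, hy⟩
    exact ⟨i, v, u, h.symm, hy, hx⟩⟩
  loopless := ⟨by
    rintro x ⟨i, u, v, h, hx, hy⟩
    subst hx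
    rw [Sigma.mk.injEq] at hy
    exact h.ne (eq_of_heq hy.2)⟩

/-- `t` disjoint copies of `G`. -/
def copies (t : ℕ) {V : Type*} (G : SimpleGraph V) : SimpleGraph (Σ _ : Fin t, V) :=
  disjUnion fun _ : Fin t => G

/-- The complete graph `K_m`. -/
abbrev K (m : ℕ) : SimpleGraph (Fin m) := ⊤

/-- `S_{n,h} = K_h ∨ (complement of K_{n-h})`, a graph of order `n` when `h ≤ n`. -/
def S (n h : ℕ) : SimpleGraph (Fin h ⊕ Fin (n - h)) := join (K h) (K (n - h))ᶜ

/-- `L_{t,h} = K_1 ∨ t K_h`, a graph of order `t * h + 1`. -/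
def L (t h : ℕ) : SimpleGraph (Fin 1 ⊕ Σ _ : Fin t, Fin h) := join (K 1) (copies t (K h))

/-- The forest `P_{2 a_1} ∪ ⋯ ∪ P_{2 a_k} ∪ P_{2 b + 1}`; here `pathGraph m` is the path with
`m` vertices. -/
def forest {k : ℕ} (a : Fin k → ℕ) (b : ℕ) :
    SimpleGraph ((Σ i : Fin k, Fin (2 * a i)) ⊕ Fin (2 * b + 1)) :=
  disjUnion (fun i => pathGraph (2 * a i)) ⊕g pathGraph (2 * b + 1)

end PathForest

namespace PathForest

/-! Take a longest path `f 0, …, f (p - 1)`. The forest has `2h + 3` vertices, so `p ≥ 2h + 3`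
suffices. Otherwise let `A` hold the indices of the neighbours of `f 0`, and `B` the successors of
the indices of the neighbours of `f (p - 1)`. If `i ∈ B` and `i + d ∈ A`, two chords close a cycle
missing exactly `d` vertices of the path. For `d = 0` connectivity would yield a longer path, so `A`
and `B` are disjoint subsets of `{1, …, p - 1}` with at least `h` elements each, and `p` is `2h + 1`
or `2h + 2`.

Case `p = 2h + 1`. If there is a `2h`-cycle, the vertices off it are independent and all attach to
the same alternate vertices of it, whence `G ⊆ S_{n,h}` (`isContained_S_of_cycle`). If not, `A = {1,
…, h}` and `B` is the rest, so the path spans two cliques of order `h + 1` sharing a vertex;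
connectivity spreads this to `G = L_{t,h}` (`iso_L_of_longest_odd`). A further block then receives
any component of order at most `h`, and only the two nearly balanced forests have no such component
(`exists_order_le_or`).

Case `p = 2h + 2`. If there is a `(2h + 1)`-cycle, two vertices off it extend an arc to the odd
component and leave exactly enough of the cycle for the even ones (`forest_isContained_of_cycle`).
If not, but some `2h`-cycle misses two consecutive path vertices, counting residues forces `h = 3`
and `G` is `K_2 ∨ tK_2` up to one edge; every forest but `P_6 ∪ P_3` is found there
(`forest_isContained_or_of_six_cycle`). In the remaining case all of `A` precedes all of `B` with at
most one index unused, and what hangs off the path provides the disjoint paths needed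
(`forest_isContained_of_longest_even`). -/

/-- The first `p` values of `f` are the successive vertices of a path of `G`. -/
structure PathSeq {V : Type*} (G : SimpleGraph V) (p : ℕ) (f : ℕ → V) : Prop where
  inj : ∀ {i j}, i < p → j < p → f i = f j → i = j
  adj : ∀ {i}, i + 1 < p → G.Adj (f i) (f (i + 1))

/-- The values of `c` are the successive vertices of a cycle of `G` of length `m`; an edge counts
as a cycle of length `2`. -/
structure CycleSeq {V : Type*} (G : SimpleGraph V) (m : ℕ) (c : ZMod m → V) : Prop where
  inj : Function.Injective c
  adj : ∀ i, G.Adj (c i) (c (i + 1))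

/-! ### Operations on paths and cycles given as vertex sequences. -/

section Sequences

variable {V : Type*} {G : SimpleGraph V}

lemma PathSeq.adj_of {p : ℕ} {f : ℕ → V} (hf : PathSeq G p f) {i j : ℕ} (hi : i < p) (hj : j < p)
    (hij : i + 1 = j ∨ j + 1 = i) : G.Adj (f i) (f j) := by
  rcases hij with rfl | rfl
  · exact hf.adj hj
  · exact (hf.adj hi).symm

lemma PathSeq.mono {p q : ℕ} {f : ℕ → V} (hf : PathSeq G p f) (h : q ≤ p) : PathSeq G q f :=
  ⟨fun hi hj => hf.inj (by omega) (by omega), fun hi => hf.adj (by omega)⟩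

lemma PathSeq.shift {p q : ℕ} {f : ℕ → V} (hf : PathSeq G p f) (s : ℕ) (h : s + q ≤ p) :
    PathSeq G q (fun i => f (s + i)) :=
  ⟨fun hi hj hij => by have := hf.inj (by omega) (by omega) hij; omega,
    fun hi => hf.adj_of (by omega) (by omega) (by omega)⟩

lemma PathSeq.rev {p : ℕ} {f : ℕ → V} (hf : PathSeq G p f) :
    PathSeq G p (fun i => f (p - 1 - i)) :=
  ⟨fun hi hj hij => by have := hf.inj (by omega) (by omega) hij; omega,
    fun hi => hf.adj_of (by omega) (by omega) (by omega)⟩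

/-- Concatenation of the first `p` terms of `f` with `g`. -/
def cat (p : ℕ) (f g : ℕ → V) (i : ℕ) : V := if i < p then f i else g (i - p)

lemma PathSeq.cat {p q : ℕ} {f g : ℕ → V} (hf : PathSeq G p f) (hg : PathSeq G q g)
    (hd : ∀ i < p, ∀ j < q, f i ≠ g j) (h : 0 < p → 0 < q → G.Adj (f (p - 1)) (g 0)) :
    PathSeq G (p + q) (cat p f g) := by
  constructor
  · intro i j hi hj hij
    simp only [PathForest.cat] at hij
    split_ifs at hij with h1 h2 h2
    · exact hf.inj h1 h2 hij
    · exact absurd hij (hd _ h1 _ (by omega))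
    · exact absurd hij.symm (hd _ h2 _ (by omega))
    · have := hg.inj (by omega) (by omega) hij
      omega
  · intro i hi
    simp only [PathForest.cat]
    split_ifs with h1 h2 h2
    · exact hf.adj h2
    · convert h (by omega) (by omega) using 2 <;> omega
    · omega
    · exact hg.adj_of (by omega) (by omega) (by omega)

lemma pathSeq_one (v : V) : PathSeq G 1 (fun _ => v) :=
  ⟨fun hi hj _ => by omega, fun hi => by omega⟩

lemma PathSeq.cons {p : ℕ} {f : ℕ → V} (hf : PathSeq G p f) {v : V} (hv : ∀ i < p, v ≠ f i)
    (h : G.Adj v (f 0)) : PathSeq G (1 + p) (PathForest.cat 1 (fun _ => v) f) :=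
  (pathSeq_one v).cat hf (fun _ _ j hj => hv j hj) fun _ _ => h

lemma PathSeq.le_card [Fintype V] {p : ℕ} {f : ℕ → V} (hf : PathSeq G p f) :
    p ≤ Fintype.card V := by
  have : Function.Injective fun i : Fin p => f i := fun i j hij => Fin.ext (hf.inj i.2 j.2 hij)
  simpa using Fintype.card_le_of_injective _ this

lemma exists_longest_pathSeq [Fintype V] [Nonempty V] (G : SimpleGraph V) :
    ∃ p f, PathSeq G p f ∧ ∀ q g, PathSeq G q g → q ≤ p := by
  classical
  obtain ⟨v⟩ := ‹Nonempty V›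
  have h1 : ∃ f, PathSeq G 1 f := ⟨_, pathSeq_one v⟩
  obtain ⟨f, hf⟩ := Nat.findGreatest_spec (P := fun p => ∃ f, PathSeq G p f)
    (n := Fintype.card V) (Fintype.card_pos_iff.2 ⟨v⟩) h1
  exact ⟨_, f, hf, fun q g hg =>
    Nat.le_findGreatest (P := fun p => ∃ f, PathSeq G p f) hg.le_card ⟨g, hg⟩⟩

lemma CycleSeq.pathSeq {m : ℕ} {c : ZMod m → V} (hc : CycleSeq G m c) (i : ZMod m) :
    PathSeq G m (fun t => c (i + t)) := by
  constructor
  · intro s t hs ht hst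
    have h := add_left_cancel (hc.inj hst)
    rw [ZMod.natCast_eq_natCast_iff'] at h
    rwa [Nat.mod_eq_of_lt hs, Nat.mod_eq_of_lt ht] at h
  · intro t _
    have := hc.adj (i + t)
    push_cast
    rwa [← add_assoc]

lemma PathSeq.cycleSeq {m : ℕ} [NeZero m] {f : ℕ → V} (hf : PathSeq G m f)
    (h : G.Adj (f (m - 1)) (f 0)) : CycleSeq G m (fun i => f i.val) := by
  constructor
  · intro i j hij
    exact ZMod.val_injective _ (hf.inj (ZMod.val_lt i) (ZMod.val_lt j) hij)
  · intro i
    have hi := ZMod.val_lt i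
    by_cases h1 : i.val + 1 < m
    · have : (i + 1).val = i.val + 1 := by
        conv_lhs => rw [← ZMod.natCast_zmod_val i, ← Nat.cast_succ]
        exact ZMod.val_natCast_of_lt h1
      simp only [this]
      exact hf.adj h1
    · have h2 : i.val = m - 1 := by omega
      have h3 : i + 1 = 0 := by
        rw [← ZMod.natCast_zmod_val i, h2, ← Nat.cast_succ, Nat.succ_eq_add_one,
          Nat.sub_add_cancel (NeZero.one_le), ZMod.natCast_self]
      simp only [h3, ZMod.val_zero, h2]
      exact h

/-- The form in which connectivity is used throughout: a structural property of vertices spreads to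
all of `G` once it is closed under adjacency. -/
lemma eq_univ_of_connected (hG : G.Connected) (s : Set V) (v : V) (hv : v ∈ s)
    (hs : ∀ x ∈ s, ∀ y, G.Adj x y → y ∈ s) (w : V) : w ∈ s := by
  obtain ⟨p⟩ := hG.preconnected v w
  induction p with
  | nil => exact hv
  | cons h _ ih => exact ih (hs _ hv _ h)

end Sequences

/-! ### Packing a path forest into one or two disjoint paths. -/

section Embedding

variable {ι : Type*}

/-- Intervals of lengths `s i` are laid end to end; each new one starts at the total length of the
earlier ones. -/
lemma exists_offsets [DecidableEq ι] (s : ι → ℕ) (I : Finset ι) :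
    ∃ o : ι → ℕ, (∀ i ∈ I, o i + s i ≤ ∑ j ∈ I, s j) ∧
      ∀ i ∈ I, ∀ j ∈ I, ∀ x < s i, ∀ y < s j, o i + x = o j + y → i = j := by
  induction I using Finset.induction_on with
  | empty => exact ⟨0, by simp, by simp⟩
  | insert a I ha ih =>
    obtain ⟨o, h1, h2⟩ := ih
    refine ⟨Function.update o a (∑ j ∈ I, s j), ?_, ?_⟩
    · intro i hi
      rw [Finset.sum_insert ha]
      rcases eq_or_ne i a with rfl | hia
      · simp [add_comm]
      · have := h1 i (Finset.mem_of_mem_insert_of_ne hi hia)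
        rw [Function.update_of_ne hia]
        omega
    · intro i hi j hj x hx y hy hxy
      rcases eq_or_ne i a with rfl | hia
      · rcases eq_or_ne j i with rfl | hja
        · rfl
        rw [Function.update_self, Function.update_of_ne hja] at hxy
        have := h1 j (Finset.mem_of_mem_insert_of_ne hj hja)
        omega
      · have hi' := Finset.mem_of_mem_insert_of_ne hi hia
        have := h1 i hi'
        rcases eq_or_ne j a with rfl | hj'
        · rw [Function.update_self, Function.update_of_ne hia] at hxy
          omega
        · rw [Function.update_of_ne hj', Function.update_of_ne hia] at hxy
          exact h2 i hi' j (Finset.mem_of_mem_insert_of_ne hj hj') x hx y hy hxy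

variable {V : Type*} {G : SimpleGraph V} {k : ℕ} {a : Fin k → ℕ} {b : ℕ}

/-- The orders of the components of `forest a b`. -/
def orders (a : Fin k → ℕ) (b : ℕ) : Option (Fin k) → ℕ
  | none => 2 * b + 1
  | some i => 2 * a i

lemma sum_orders (a : Fin k → ℕ) (b : ℕ) :
    ∑ i, orders a b i = 2 * ∑ i, a i + (2 * b + 1) := by
  rw [Fintype.sum_option, Finset.mul_sum, add_comm]
  rfl

lemma forest_isContained_of_family (f : Option (Fin k) → ℕ → V)
    (hf : ∀ i, PathSeq G (orders a b i) (f i))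
    (hd : ∀ i j, ∀ x < orders a b i, ∀ y < orders a b j, f i x = f j y → i = j) :
    forest a b ⊑ G := by
  have key : ∀ i, ∀ u v : Fin (orders a b i), (pathGraph (orders a b i)).Adj u v →
      G.Adj (f i u) (f i v) := by
    intro i u v huv
    rw [pathGraph_adj] at huv
    exact (hf i).adj_of u.2 v.2 huv
  refine ⟨⟨⟨Sum.elim (fun x => f (some x.1) x.2) (fun x => f none x), ?_⟩, ?_⟩⟩
  · rintro (⟨i, u⟩ | u) (⟨j, v⟩ | v) h
    · simp only [forest, sum_adj, disjUnion] at h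
      obtain ⟨i', u', v', h, h1, h2⟩ := h
      rw [Sigma.mk.injEq] at h1 h2
      obtain ⟨rfl, h1⟩ := h1
      obtain ⟨rfl, h2⟩ := h2
      rw [eq_of_heq h1, eq_of_heq h2]
      exact key (some _) u' v' h
    · simp [forest] at h
    · simp [forest] at h
    · simp only [forest, sum_adj] at h
      exact key none u v h
  · rintro (⟨i, u⟩ | u) (⟨j, v⟩ | v) h
    · have h' : f (some i) u = f (some j) v := h
      have := hd (some i) (some j) u u.2 v v.2 h'
      obtain rfl : i = j := by simpa using this
      rw [Fin.ext ((hf (some i)).inj u.2 v.2 h')]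
    · exact absurd (hd (some i) none u u.2 v v.2 h) (by simp)
    · exact absurd (hd none (some j) u u.2 v v.2 h) (by simp)
    · rw [Fin.ext ((hf none).inj u.2 v.2 h)]

lemma forest_isContained_of_two_paths {p q : ℕ} {f g : ℕ → V} (hf : PathSeq G p f)
    (hg : PathSeq G q g) (hd : ∀ i < p, ∀ j < q, f i ≠ g j) (I : Finset (Option (Fin k)))
    (hp : ∑ i ∈ I, orders a b i ≤ p) (hq : ∑ i ∈ Iᶜ, orders a b i ≤ q) : forest a b ⊑ G := by
  obtain ⟨o, ho, ho'⟩ := exists_offsets (orders a b) I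
  obtain ⟨o₂, ho₂, ho₂'⟩ := exists_offsets (orders a b) Iᶜ
  refine forest_isContained_of_family
    (fun i x => if i ∈ I then f (o i + x) else g (o₂ i + x)) ?_ ?_
  · intro i
    by_cases hi : i ∈ I
    · simp only [hi, if_true]
      exact hf.shift _ ((ho i hi).trans hp)
    · simp only [hi, if_false]
      exact hg.shift _ ((ho₂ i (by simpa using hi)).trans hq)
  · intro i j x hx y hy hxy
    have h1 := ho i
    have h2 := ho j
    have h3 := ho₂ i
    have h4 := ho₂ j
    simp only [Finset.mem_compl] at h3 h4 ho₂'
    split_ifs at hxy with hi hj hj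
    · specialize h1 hi
      specialize h2 hj
      exact ho' i hi j hj x hx y hy (hf.inj (by omega) (by omega) hxy)
    · specialize h1 hi
      specialize h4 hj
      exact absurd hxy (hd _ (by omega) _ (by omega))
    · specialize h2 hj
      specialize h3 hi
      exact absurd hxy.symm (hd _ (by omega) _ (by omega))
    · specialize h3 hi
      specialize h4 hj
      exact ho₂' i hi j hj x hx y hy (hg.inj (by omega) (by omega) hxy)

lemma forest_isContained_of_even_odd {p q h : ℕ} {f g : ℕ → V} (hh : h + 1 = (∑ i, a i) + b)
    (hf : PathSeq G p f) (hg : PathSeq G q g) (hd : ∀ i < p, ∀ j < q, f i ≠ g j)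
    (hp : 2 * b + 1 ≤ p) (hq : 2 * (h + 1 - b) ≤ q) : forest a b ⊑ G := by
  refine forest_isContained_of_two_paths hf hg hd {none} (by simpa [orders] using hp) ?_
  have := sum_orders a b
  rw [← Finset.sum_add_sum_compl {none}, Finset.sum_singleton] at this
  simp only [orders] at this ⊢
  omega

lemma forest_isContained_of_path {p h : ℕ} {f : ℕ → V} (hh : h + 1 = (∑ i, a i) + b)
    (hf : PathSeq G p f) (hp : 2 * h + 3 ≤ p) : forest a b ⊑ G := by
  refine forest_isContained_of_two_paths (q := 0) (g := f) hf ⟨by omega, by omega⟩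
    (by simp) Finset.univ ?_ (by simp)
  rw [sum_orders]
  omega

lemma forest_isContained_of_order_le {m p q h : ℕ} {f g : ℕ → V} (hh : h + 1 = (∑ i, a i) + b)
    (hf : PathSeq G p f) (hg : PathSeq G q g) (hd : ∀ i < p, ∀ j < q, f i ≠ g j)
    (i : Option (Fin k)) (hi : orders a b i ≤ p) (hm : m ≤ orders a b i)
    (hq : 2 * h + 3 ≤ q + m) : forest a b ⊑ G := by
  refine forest_isContained_of_two_paths hf hg hd {i} (by simpa using hi) ?_
  have := sum_orders a b
  rw [← Finset.sum_add_sum_compl {i}, Finset.sum_singleton] at this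
  omega

/-- The `k + 1` components have total order `2h + 3 < 3(h + 1)`, so they cannot all exceed `h` when
`k ≥ 2`. For `k = 1`, both `2a` and `2b + 1` being at least `h + 1 = a + b` leaves only `a = b` and
`a = b + 1`. -/
lemma exists_order_le_or {h : ℕ} (ha : ∀ i, 1 ≤ a i) (hk : 1 ≤ k) (hh1 : 1 ≤ h)
    (hh : h + 1 = (∑ i, a i) + b) :
    (∃ i, orders a b i ≤ h) ∨ k = 1 ∧ ∀ i, a i = b ∨ a i = b + 1 := by
  by_contra! hcon
  obtain ⟨h1, h2⟩ := hcon
  have hb := h1 none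
  simp only [orders] at hb
  have ha' : ∀ i, h + 1 ≤ 2 * a i := fun i => h1 (some i)
  have hs : k * (h + 1) ≤ 2 * ∑ i, a i := by
    rw [Finset.mul_sum]
    simpa using Finset.sum_le_sum (s := Finset.univ) fun i _ => ha' i
  have hk1 : k = 1 := by
    by_contra hk1
    have : 2 * (h + 1) ≤ k * (h + 1) := Nat.mul_le_mul_right _ (by omega)
    omega
  obtain ⟨i, hi⟩ := h2 hk1
  have := ha' i
  subst hk1
  obtain rfl : i = 0 := Subsingleton.elim _ _
  simp only [Fin.sum_univ_one] at hh
  omega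

lemma nonempty_forest_iso {a : Fin k → ℕ} (hk : k = 1) {m : ℕ} (hm : ∀ i, a i = m) :
    Nonempty (forest a b ≃g (pathGraph (2 * m) ⊕g pathGraph (2 * b + 1))) := by
  subst hk
  obtain rfl : a = fun _ => m := funext hm
  refine ⟨⟨Equiv.sumCongr (Equiv.uniqueSigma fun _ : Fin 1 => Fin (2 * m)) (Equiv.refl _), ?_⟩⟩
  rintro (⟨i, u⟩ | u) (⟨j, v⟩ | v)
  · obtain rfl : i = 0 := Subsingleton.elim _ _
    obtain rfl : j = 0 := Subsingleton.elim _ _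
    simp only [forest, disjUnion, sum_adj, Equiv.sumCongr_apply, Sum.map_inl,
      Equiv.uniqueSigma_apply]
    constructor
    · intro h
      exact ⟨0, u, v, h, rfl, rfl⟩
    · rintro ⟨i, u', v', h, h1, h2⟩
      obtain rfl : i = 0 := Subsingleton.elim _ _
      rw [Sigma.mk.injEq] at h1 h2
      rw [eq_of_heq h1.2, eq_of_heq h2.2]
      exact h
  · simp [forest]
  · simp [forest]
  · simp [forest]

end Embedding

/-! ### Extending and modifying cycles. -/

section Cycles

variable {V : Type*} {G : SimpleGraph V} {m : ℕ} {c : ZMod m → V}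

lemma CycleSeq.exists_pathSeq_cons (hc : CycleSeq G m c) {y : V} (hy : ∀ i, y ≠ c i) {i : ZMod m}
    (h : G.Adj y (c i)) : PathSeq G (1 + m) (PathForest.cat 1 (fun _ => y) fun t => c (i + t)) :=
  (hc.pathSeq i).cons (fun _ _ => hy _) (by simpa using h)

lemma CycleSeq.update [DecidableEq (ZMod m)] (hc : CycleSeq G m c) {y : V} (hy : ∀ i, y ≠ c i)
    {j : ZMod m} (h : G.Adj y (c (j - 1))) (h' : G.Adj y (c (j + 1))) :
    CycleSeq G m (Function.update c j y) := by
  have h1 : j + 1 ≠ j := by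
    intro h1
    rw [show j - 1 = j by linear_combination -h1] at h
    have := hc.adj j
    rw [h1] at this
    exact this.ne rfl
  constructor
  · intro s t hst
    by_cases hs : s = j <;> by_cases ht : t = j
    · rw [hs, ht]
    · subst hs
      rw [Function.update_self, Function.update_of_ne ht] at hst
      exact absurd hst (hy t)
    · subst ht
      rw [Function.update_self, Function.update_of_ne hs] at hst
      exact absurd hst.symm (hy s)
    · rw [Function.update_of_ne ht, Function.update_of_ne hs] at hst
      exact hc.inj hst
  · intro i
    by_cases hi : i = j
    · subst hi
      rwa [Function.update_self, Function.update_of_ne h1]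
    · by_cases hi' : i + 1 = j
      · subst hi'
        rw [Function.update_self, Function.update_of_ne hi]
        simpa using h.symm
      · rw [Function.update_of_ne hi, Function.update_of_ne hi']
        exact hc.adj i

variable [NeZero m]

lemma CycleSeq.exists_notMem [Fintype V] (hm : m < Fintype.card V) (c : ZMod m → V) :
    ∃ y, ∀ i, y ≠ c i := by
  classical
  by_contra! hcon
  have h : Function.Surjective c := fun y => by
    obtain ⟨i, hi⟩ := hcon y
    exact ⟨i, hi.symm⟩
  have := Fintype.card_le_of_surjective c h
  rw [ZMod.card] at this
  omega

/-- Some edge leaves the cycle; its outer end followed by the cycle, opened at the inner end, is the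
path. -/
lemma CycleSeq.exists_longer [Fintype V] (hG : G.Connected) (hc : CycleSeq G m c)
    (hm : m < Fintype.card V) : ∃ g, PathSeq G (1 + m) g := by
  by_contra! hcon
  obtain ⟨y, hy⟩ := exists_notMem hm c
  have := eq_univ_of_connected hG (Set.range c) (c 0) ⟨0, rfl⟩ ?_ y
  · obtain ⟨i, hi⟩ := this
    exact hy i hi.symm
  · rintro _ ⟨i, rfl⟩ z hz
    by_contra hz'
    exact hcon _ (hc.exists_pathSeq_cons (fun i hi => hz' ⟨i, hi.symm⟩) hz.symm)

lemma CycleSeq.cons (hc : CycleSeq G m c) {y : V} (hy : ∀ i, y ≠ c i) {i : ZMod m}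
    (h : G.Adj y (c i)) (h' : G.Adj y (c (i + 1))) : 
    ∃ c' : ZMod (m + 1) → V, CycleSeq G (m + 1) c' := by
  rw [add_comm m 1]
  have hm := NeZero.ne m
  have : NeZero (1 + m) := ⟨by omega⟩
  refine ⟨_, (hc.exists_pathSeq_cons hy h').cycleSeq ?_⟩
  obtain ⟨n, rfl⟩ := Nat.exists_eq_succ_of_ne_zero hm
  have h1 : ((n + 1 : ℕ) : ZMod (n + 1)) = 0 := ZMod.natCast_self _
  have h2 : i + 1 + (n : ZMod (n + 1)) = i := by
    push_cast at h1
    linear_combination h1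
  simp [PathForest.cat, h2, h.symm]

/-- The indices of the vertices of `c` that are adjacent to `y`. -/
noncomputable def cycleNbrs (G : SimpleGraph V) (c : ZMod m → V) (y : V) : Finset (ZMod m) :=
  open Classical in Finset.univ.filter fun i => G.Adj y (c i)


lemma mem_cycleNbrs {y : V} {i : ZMod m} : i ∈ cycleNbrs G c y ↔ G.Adj y (c i) := by
  simp [cycleNbrs]

lemma minDegree_le_card_add [Fintype V] [DecidableRel G.Adj] {y : V} (t : Finset V)
    (h : ∀ z, G.Adj y z → z ∈ t ∨ ∃ i, z = c i) :
    G.minDegree ≤ t.card + (cycleNbrs G c y).card := by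
  classical
  refine (G.minDegree_le_degree y).trans ?_
  rw [← G.card_neighborFinset_eq_degree]
  calc _ ≤ (t ∪ (cycleNbrs G c y).image c).card := by
        refine Finset.card_le_card fun z hz => ?_
        rw [mem_neighborFinset] at hz
        rw [Finset.mem_union, Finset.mem_image]
        rcases h z hz with h1 | ⟨i, rfl⟩
        · exact Or.inl h1
        · exact Or.inr ⟨i, mem_cycleNbrs.2 hz, rfl⟩
    _ ≤ _ := (Finset.card_union_le _ _).trans (Nat.add_le_add_left Finset.card_image_le _)

end Cycles

/-! ### Vertices off a cycle that is one vertex shorter than a longest path. -/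

section NearHamiltonianCycle

variable {V : Type*} {G : SimpleGraph V} {m : ℕ} [NeZero m] {c : ZMod m → V}

/-- Two adjacent outside vertices, one of them attached to the cycle, would give a path with `m + 2`
vertices. By connectivity every outside vertex is attached, so the outside is independent. -/
lemma exists_eq_of_adj_of_outside (hG : G.Connected) (hmax : ∀ q g, PathSeq G q g → q ≤ m + 1)
    (hc : CycleSeq G m c) {y z : V} (hy : ∀ i, y ≠ c i) (h : G.Adj y z) : ∃ i, z = c i := by
  have key : ∀ y z i, (∀ i, y ≠ c i) → G.Adj y (c i) → G.Adj y z → ∃ j, z = c j := by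
    intro y z i hy hi hz
    by_contra! hcon
    have h1 := hc.exists_pathSeq_cons hy hi
    have := hmax _ _ (h1.cons (v := z) ?_ hz.symm)
    · omega
    · intro j _
      simp only [cat]
      split_ifs
      · exact hz.symm.ne
      · exact hcon _
  have hy' := eq_univ_of_connected hG {v | (∃ i, v = c i) ∨ ∃ i, G.Adj v (c i)} (c 0)
    (Or.inl ⟨0, rfl⟩) ?_ y
  · rcases hy' with ⟨i, hi⟩ | ⟨i, hi⟩
    · exact absurd hi (hy i)
    · exact key y z i hy hi h
  · intro x hx z hz
    by_cases hx' : ∃ i, x = c i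
    · obtain ⟨i, rfl⟩ := hx'
      exact Or.inr ⟨i, hz.symm⟩
    · obtain ⟨i, hi⟩ := hx.resolve_left hx'
      push Not at hx'
      exact Or.inl (key x z i hx' hi hz)

/-- If `y ≠ z`, going round the cycle from `c (i + 1)` to `c i` joins `z` to `y` by a path on `m +
2` vertices. If `y = z`, it can be inserted into the cycle, and the longer cycle extends to such a
path. -/
lemma not_adj_succ_of_outside [Fintype V] (hG : G.Connected)
    (hmax : ∀ q g, PathSeq G q g → q ≤ m + 1) (hV : m + 1 < Fintype.card V)
    (hc : CycleSeq G m c) {y z : V} (hy : ∀ i, y ≠ c i) (hz : ∀ i, z ≠ c i) {i : ZMod m}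
    (hi : G.Adj y (c i)) : ¬ G.Adj z (c (i + 1)) := by
  intro hi'
  by_cases hyz : y = z
  · subst hyz
    obtain ⟨c', hc'⟩ := hc.cons hy hi hi'
    obtain ⟨g, hg⟩ := hc'.exists_longer hG (by omega)
    have := hmax _ _ hg
    omega
  · have hm := NeZero.ne m
    have h1 := (hc.exists_pathSeq_cons hz hi').cat (pathSeq_one y) ?_ ?_
    · have := hmax _ _ h1
      omega
    · intro j _ _ _
      simp only [cat]
      split_ifs
      · exact Ne.symm hyz
      · exact (hy _).symm
    · intro _ _
      obtain ⟨n, rfl⟩ := Nat.exists_eq_succ_of_ne_zero hm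
      have h1 : ((n + 1 : ℕ) : ZMod (n + 1)) = 0 := ZMod.natCast_self _
      have h2 : i + 1 + (n : ZMod (n + 1)) = i := by
        push_cast at h1
        linear_combination h1
      simp [PathForest.cat, h2, hi.symm]

end NearHamiltonianCycle

/-! ### A `2h`-cycle under a longest path of `2h + 1` vertices: containment in `S_{n,h}`. -/

section EvenCycle

variable {V : Type*} [Fintype V] {G : SimpleGraph V} {h : ℕ}

lemma isContained_S_of_cover {n : ℕ} (hn : Fintype.card V = n) (E : Finset V) (hE : E.card = h)
    (hcov : ∀ x y, G.Adj x y → x ∈ E ∨ y ∈ E) : G ⊑ S n h := by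
  classical
  have e1 : {x // x ∈ E} ≃ Fin h := Fintype.equivFinOfCardEq (by simpa using hE)
  have e2 : {x // x ∉ E} ≃ Fin (n - h) := Fintype.equivFinOfCardEq (by
    rw [Fintype.card_subtype_compl, hn]
    simp [hE])
  let φ := (Equiv.sumCompl (· ∈ E)).symm.trans (Equiv.sumCongr e1 e2)
  refine ⟨⟨⟨φ, ?_⟩, φ.injective⟩⟩
  intro x y hxy
  by_cases hx : x ∈ E <;> by_cases hy : y ∈ E
  · simpa [φ, hx, hy, S, join] using hxy.ne
  · simp [φ, hx, hy, S, join]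
  · simp [φ, hx, hy, S, join]
  · exact absurd (hcov x y hxy) (by tauto)

variable [DecidableRel G.Adj]

/-- A cycle of length `2h` in a graph whose longest paths have at most `2h + 1` vertices. -/
lemma isContained_S_of_cycle {n : ℕ} (hn : Fintype.card V = n) (hh : 1 ≤ h) (hn' : 2 * h + 3 ≤ n)
    (hG : G.Connected) (hδ : h ≤ G.minDegree) (hmax : ∀ q g, PathSeq G q g → q ≤ 2 * h + 1)
    {c : ZMod (2 * h) → V} (hc : CycleSeq G (2 * h) c) : G ⊑ S n h := by
  classical
  have : NeZero (2 * h) := ⟨by omega⟩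
  have card_le : ∀ c : ZMod (2 * h) → V, CycleSeq G (2 * h) c → ∀ y, (∀ i, y ≠ c i) →
      h ≤ (cycleNbrs G c y).card := by
    intro c hc y hy
    have := minDegree_le_card_add (G := G) (c := c) (y := y) ∅ fun z hz =>
      Or.inr (exists_eq_of_adj_of_outside hG hmax hc hy hz)
    simp only [Finset.card_empty] at this
    omega
  have succ_iff : ∀ c : ZMod (2 * h) → V, CycleSeq G (2 * h) c → ∀ y z, (∀ i, y ≠ c i) →
      (∀ i, z ≠ c i) → ∀ i, G.Adj z (c (i + 1)) ↔ ¬ G.Adj y (c i) := by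
    intro c hc y z hy hz
    -- Both neighbourhoods have at least `h` of the `2h` residues, so this inclusion is an equality.
    have hsub : (cycleNbrs G c y).map (addRightEmbedding 1) ⊆ (cycleNbrs G c z)ᶜ := by
      intro i hi
      simp only [Finset.mem_map, mem_cycleNbrs, addRightEmbedding_apply] at hi
      obtain ⟨j, hj, rfl⟩ := hi
      rw [Finset.mem_compl, mem_cycleNbrs]
      exact not_adj_succ_of_outside hG hmax (by omega) hc hy hz hj
    have heq := Finset.eq_of_subset_of_card_le hsub (by
      rw [Finset.card_compl, Finset.card_map, ZMod.card]
      have := card_le c hc y hy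
      have := card_le c hc z hz
      omega)
    intro i
    have : i + 1 ∈ (cycleNbrs G c y).map (addRightEmbedding 1) ↔ i + 1 ∈ (cycleNbrs G c z)ᶜ := by
      rw [heq]
    simp only [Finset.mem_map, mem_cycleNbrs, addRightEmbedding_apply, Finset.mem_compl,
      add_left_inj, exists_eq_right] at this
    tauto
  have adj_iff : ∀ c : ZMod (2 * h) → V, CycleSeq G (2 * h) c → ∀ y z, (∀ i, y ≠ c i) →
      (∀ i, z ≠ c i) → ∀ i, G.Adj z (c i) ↔ G.Adj y (c i) := by
    intro c hc y z hy hz i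
    have h1 := succ_iff c hc y z hy hz (i - 1)
    have h2 := succ_iff c hc y y hy hy (i - 1)
    rw [sub_add_cancel] at h1 h2
    rw [h1, h2]
  -- Two outside vertices are needed: `z` stays outside when `y` is later swapped into the cycle.
  obtain ⟨y, hy⟩ := CycleSeq.exists_notMem (by omega : 2 * h < Fintype.card V) c
  obtain ⟨z, hz, hzy⟩ : ∃ z, (∀ i, z ≠ c i) ∧ z ≠ y := by
    by_contra! hcon
    have : Finset.univ ⊆ insert y (Finset.univ.image c) := by
      intro z _
      by_cases hz : ∀ i, z ≠ c i
      · simp [hcon z hz]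
      · push Not at hz
        obtain ⟨i, rfl⟩ := hz
        simp
    have := (Finset.card_le_card this).trans (Finset.card_insert_le _ _)
    have h2 := Finset.card_image_le (s := Finset.univ) (f := c)
    simp only [Finset.card_univ, ZMod.card] at this h2
    omega
  have hcard : (cycleNbrs G c y).card = h := by
    have h1 : (cycleNbrs G c y).map (addRightEmbedding 1) = (cycleNbrs G c y)ᶜ := by
      ext i
      have := succ_iff c hc y y hy hy (i - 1)
      rw [sub_add_cancel] at this
      simp only [Finset.mem_map, mem_cycleNbrs, addRightEmbedding_apply, Finset.mem_compl]
      rw [this, not_not]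
      constructor
      · rintro ⟨j, hj, rfl⟩
        simpa using hj
      · intro hi
        exact ⟨_, hi, by simp⟩
    have := congrArg Finset.card h1
    rw [Finset.card_compl, Finset.card_map, ZMod.card] at this
    have := card_le c hc y hy
    omega
  have outside : ∀ x, (∀ i, x ≠ c i) → ∀ v, G.Adj x v → v ∈ (cycleNbrs G c y).image c := by
    intro x hx v hv
    obtain ⟨i, rfl⟩ := exists_eq_of_adj_of_outside hG hmax hc hx hv
    exact Finset.mem_image_of_mem _ (mem_cycleNbrs.2 ((adj_iff c hc y x hy hx i).1 hv))
  refine isContained_S_of_cover hn ((cycleNbrs G c y).image c) ?_ ?_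
  · rwa [Finset.card_image_of_injective _ hc.inj]
  intro u v huv
  by_cases hu : ∀ i, u ≠ c i
  · exact Or.inr (outside u hu v huv)
  by_cases hv : ∀ i, v ≠ c i
  · exact Or.inl (outside v hv u huv.symm)
  push Not at hu hv
  obtain ⟨j, rfl⟩ := hu
  obtain ⟨i, rfl⟩ := hv
  by_contra! hcon
  obtain ⟨hj, hi⟩ := hcon
  have hj : ¬ G.Adj y (c j) := fun h' => hj (Finset.mem_image_of_mem _ (mem_cycleNbrs.2 h'))
  have hi : ¬ G.Adj y (c i) := fun h' => hi (Finset.mem_image_of_mem _ (mem_cycleNbrs.2 h'))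
  have hij : i ≠ j := by
    rintro rfl
    exact huv.ne rfl
  have h1 : G.Adj y (c (j + 1)) := (succ_iff c hc y y hy hy j).2 hj
  have h2 : G.Adj y (c (j - 1)) := by
    have := succ_iff c hc y y hy hy (j - 1)
    rw [sub_add_cancel] at this
    tauto
  -- With `y` in place of the non-neighbour `c j`, the vertex `c j` is outside the new cycle and so
  -- has the same neighbours on it as `z`. Hence `c j` is not adjacent to `c i`.
  have hc' := hc.update hy h2 h1
  have hz' : ∀ i, z ≠ Function.update c j y i := by
    intro i
    by_cases hi : i = j
    · subst hi
      rwa [Function.update_self]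
    · rw [Function.update_of_ne hi]
      exact hz i
  have hj' : ∀ i, c j ≠ Function.update c j y i := by
    intro i
    by_cases hi : i = j
    · subst hi
      rw [Function.update_self]
      exact (hy _).symm
    · rw [Function.update_of_ne hi]
      exact fun h' => hi (hc.inj h').symm
  have h3 := adj_iff _ hc' z (c j) hz' hj' i
  rw [Function.update_of_ne hij] at h3
  exact hi ((adj_iff c hc y z hy hz i).1 (h3.1 huv))

end EvenCycle

/-! ### A `(2h + 1)`-cycle under a longest path of `2h + 2` vertices. -/

section OddCycle

/-- Sets of at least `h` residues modulo `2h + 1` that avoid each other's successors contain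
every even difference up to `2(h - 1)`. -/
lemma exists_mem_add_mem {h : ℕ} (hh : 1 ≤ h) (s t : Finset (ZMod (2 * h + 1)))
    (hs : h ≤ s.card) (ht : h ≤ t.card) (hss : ∀ i ∈ s, i + 1 ∉ s) (hst : ∀ i ∈ s, i + 1 ∉ t)
    (hts : ∀ i ∈ t, i + 1 ∉ s) (k : ℕ) (hk : k < h) : ∃ i ∈ s, i + 2 * (k : ZMod (2 * h + 1)) ∈ t := by
  classical
  have h2 : (2 * h + 1 : ZMod (2 * h + 1)) = 0 := by
    exact_mod_cast ZMod.natCast_self (2 * h + 1)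
  -- Otherwise `s` is closed under adding `2`, and `h + 1` such steps lead from `i` to the forbidden
  -- `i + 1`.
  obtain ⟨i₀, hi₀, hi₀'⟩ : ∃ i ∈ s, i + 2 ∉ s := by
    by_contra! hcon
    obtain ⟨i, hi⟩ := Finset.card_pos.1 (by omega : 0 < s.card)
    have : ∀ k : ℕ, i + 2 * (k : ZMod (2 * h + 1)) ∈ s := by
      intro k
      induction k with
      | zero => simpa using hi
      | succ k ih =>
        have := hcon _ ih
        push_cast
        convert this using 1
        ring
    have h3 := this (h + 1)
    have h4 : i + 2 * ((h + 1 : ℕ) : ZMod (2 * h + 1)) = i + 1 := by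
      push_cast
      linear_combination h2
    rw [h4] at h3
    exact hss i hi h3
  -- `R` is `s - 1` together with `i₀ + 1`. It has at least `h + 1` elements and misses both `s` and
  -- `t`, so `s` and `t` both equal its complement.
  set R : Finset (ZMod (2 * h + 1)) := insert (i₀ + 1) (s.map (addRightEmbedding (-1))) with hR
  have hi₁ : i₀ + 1 ∉ s.map (addRightEmbedding (-1)) := by
    simp only [Finset.mem_map, addRightEmbedding_apply, not_exists, not_and]
    intro j hj hj'
    apply hi₀'
    convert hj using 1
    linear_combination -hj'
  have hRcard : R.card = s.card + 1 := by
    rw [hR, Finset.card_insert_of_notMem hi₁, Finset.card_map]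
  have avoid : ∀ u : Finset (ZMod (2 * h + 1)), (∀ i ∈ s, i + 1 ∉ u) → (∀ i ∈ u, i + 1 ∉ s) →
      u ⊆ Rᶜ := by
    intro u h1 h2 i hi
    rw [Finset.mem_compl, hR, Finset.mem_insert, not_or]
    constructor
    · rintro rfl
      exact h1 _ hi₀ hi
    · simp only [Finset.mem_map, addRightEmbedding_apply, not_exists, not_and]
      rintro j hj rfl
      have := h2 _ hi
      rw [neg_add_cancel_right] at this
      exact this hj
  have hsR := avoid s hss hss
  have htR := avoid t hst hts
  have hRc : Rᶜ.card ≤ h := by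
    rw [Finset.card_compl, ZMod.card]
    omega
  have hs' := Finset.eq_of_subset_of_card_le hsR (by omega)
  have ht' := Finset.eq_of_subset_of_card_le htR (by omega)
  have hts' : t = s := ht'.trans hs'.symm
  have hcard : s.card = h := by
    have := Finset.card_le_card hsR
    omega
  have uniq : ∀ i ∈ s, i + 2 ∉ s → i = i₀ := by
    intro i hi hi'
    have h3 : i + 1 ∉ s := hss i hi
    rw [hs', Finset.mem_compl, not_not, hR, Finset.mem_insert] at h3
    rcases h3 with h3 | h3
    · exact add_right_cancel h3
    · simp only [Finset.mem_map, addRightEmbedding_apply] at h3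
      obtain ⟨j, hj, hj'⟩ := h3
      exfalso
      apply hi'
      convert hj using 1
      linear_combination -hj'
  -- Only `i₀` leaves `s` when `2` is added, so each step loses at most one starting point; since
  -- `s` has `h > k` elements, one survives.
  have bad : ∀ k : ℕ, (s.filter fun i => i + 2 * (k : ZMod (2 * h + 1)) ∉ s).card ≤ k := by
    intro k
    induction k with
    | zero => simp
    | succ k ih =>
      have hsub : (s.filter fun i => i + 2 * ((k + 1 : ℕ) : ZMod (2 * h + 1)) ∉ s) ⊆
          insert (i₀ - 2 * k) (s.filter fun i => i + 2 * (k : ZMod (2 * h + 1)) ∉ s) := by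
        intro i hi
        rw [Finset.mem_filter] at hi
        rw [Finset.mem_insert, Finset.mem_filter]
        by_cases hik : i + 2 * (k : ZMod (2 * h + 1)) ∈ s
        · left
          have := uniq _ hik (by
            have := hi.2
            push_cast at this
            convert this using 2
            ring)
          linear_combination this
        · exact Or.inr ⟨hi.1, hik⟩
      have := (Finset.card_le_card hsub).trans (Finset.card_insert_le _ _)
      omega
  by_contra! hcon
  rw [hts'] at hcon
  have := bad k
  rw [Finset.filter_true_of_mem hcon] at this
  omega

variable {V : Type*} [Fintype V] {G : SimpleGraph V} [DecidableRel G.Adj]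

/-- A cycle of length `2h + 1` in a graph whose longest paths have at most `2h + 2` vertices. -/
lemma forest_isContained_of_cycle {k : ℕ} {a : Fin k → ℕ} {b h : ℕ} (hk : 1 ≤ k)
    (ha : ∀ i, 1 ≤ a i) (hb : 1 ≤ b) (hh : h + 1 = (∑ i, a i) + b) (hh1 : 1 ≤ h)
    (hn : 2 * h + 3 ≤ Fintype.card V) (hG : G.Connected) (hδ : h ≤ G.minDegree)
    (hmax : ∀ q g, PathSeq G q g → q ≤ 2 * h + 2)
    {c : ZMod (2 * h + 1) → V} (hc : CycleSeq G (2 * h + 1) c) : forest a b ⊑ G := by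
  classical
  have hbh : b ≤ h := by
    have : a ⟨0, hk⟩ ≤ ∑ i, a i :=
      Finset.single_le_sum (fun _ _ => Nat.zero_le _) (Finset.mem_univ _)
    have := ha ⟨0, hk⟩
    omega
  have card_le : ∀ y, (∀ i, y ≠ c i) → h ≤ (cycleNbrs G c y).card := by
    intro y hy
    have := minDegree_le_card_add (G := G) (c := c) (y := y) ∅ fun z hz =>
      Or.inr (exists_eq_of_adj_of_outside hG hmax hc hy hz)
    simp only [Finset.card_empty] at this
    omega
  obtain ⟨y, hy⟩ := CycleSeq.exists_notMem (by omega : 2 * h + 1 < Fintype.card V) c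
  obtain ⟨z, hz, hzy⟩ : ∃ z, (∀ i, z ≠ c i) ∧ z ≠ y := by
    by_contra! hcon
    have : Finset.univ ⊆ insert y (Finset.univ.image c) := by
      intro z _
      by_cases hz : ∀ i, z ≠ c i
      · simp [hcon z hz]
      · push Not at hz
        obtain ⟨i, rfl⟩ := hz
        simp
    have := (Finset.card_le_card this).trans (Finset.card_insert_le _ _)
    have h2 := Finset.card_image_le (s := Finset.univ) (f := c)
    simp only [Finset.card_univ, ZMod.card] at this h2
    omega
  have avoid : ∀ y z, (∀ i, y ≠ c i) → (∀ i, z ≠ c i) →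
      ∀ i ∈ cycleNbrs G c y, i + 1 ∉ cycleNbrs G c z := by
    intro y z hy hz i hi
    rw [mem_cycleNbrs] at hi ⊢
    exact not_adj_succ_of_outside hG hmax (by omega) hc hy hz hi
  -- Shift `2(b - 1)`: the arc from the neighbour of `y` to that of `z` has `2b - 1` vertices, so
  -- `y` and `z` complete it to the odd component, and `2(h + 1 - b)` cycle vertices remain for the
  -- even ones.
  obtain ⟨i, hi, hi'⟩ := exists_mem_add_mem hh1 _ _ (card_le y hy) (card_le z hz) (avoid y y hy hy)
    (avoid y z hy hz) (avoid z y hz hy) (b - 1) (by omega)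
  rw [mem_cycleNbrs] at hi hi'
  have hp := hc.pathSeq i
  have h1 := (((hp.mono (by omega : 2 * b - 1 ≤ 2 * h + 1)).cons (fun _ _ => hy _)
    (by simpa using hi)).cat (pathSeq_one z) ?_ ?_)
  · refine forest_isContained_of_even_odd hh h1 (hp.shift (q := 2 * (h + 1 - b)) (2 * b - 1)
      (by omega)) ?_ (by omega) le_rfl
    intro s hs t ht
    simp only [cat]
    split_ifs with h1 h2
    · exact hy _
    · intro h3
      have := hp.inj (by omega) (by omega) h3
      omega
    · exact hz _
  · intro s _ t _
    simp only [cat]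
    split_ifs
    · exact hzy.symm
    · exact (hz _).symm
  · intro _ _
    have h2 : ((1 + (2 * b - 1) - 1 - 1 : ℕ) : ZMod (2 * h + 1)) = 2 * ((b - 1 : ℕ) : ZMod _) := by
      rw [show 1 + (2 * b - 1) - 1 - 1 = 2 * (b - 1) by omega]
      push_cast
      rfl
    have h3 : ¬ (1 + (2 * b - 1) - 1 < 1) := by omega
    simp only [cat, h3, if_false, h2]
    exact hi'.symm

end OddCycle

/-! ### An edge disjoint from a `2h`-cycle under a longest path of `2h + 2` vertices. -/

section OutsideEdge

/-- The sets `s`, `t + 1`, `t + 2` are pairwise disjoint, so `3(h - 1) ≤ 2h` and `h ≤ 3`; the two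
remaining moduli are checked directly. -/
lemma residues_of_avoid {h : ℕ} (hh : 2 ≤ h) (s t : Finset (ZMod (2 * h)))
    (hs : h ≤ s.card + 1) (ht : h ≤ t.card + 1) (hss : ∀ i ∈ s, i + 1 ∉ s)
    (htt : ∀ i ∈ t, i + 1 ∉ t) (hst : ∀ i ∈ s, i + 1 ∉ t) (hts : ∀ i ∈ t, i + 1 ∉ s)
    (hst' : ∀ i ∈ s, i + 2 ∉ t) (hts' : ∀ i ∈ t, i + 2 ∉ s) (i : ZMod (2 * h)) (hi : i ∈ s) :
    (h = 2 ∧ ∀ j ∈ t, j = i) ∨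
      (h = 3 ∧ ∀ j, (j ∈ s ↔ j = i ∨ j = i + 3) ∧ (j ∈ t ↔ j = i ∨ j = i + 3)) := by
  classical
  have : NeZero (2 * h) := ⟨by omega⟩
  have key : ∀ s t : Finset (ZMod (2 * h)), (∀ i ∈ t, i + 1 ∉ t) → (∀ i ∈ t, i + 1 ∉ s) →
      (∀ i ∈ t, i + 2 ∉ s) → s.card + 2 * t.card ≤ 2 * h := by
    intro s t htt hts hts'
    have h1 : Disjoint s (t.map (addRightEmbedding 1)) := by
      rw [Finset.disjoint_left]
      intro j hj hj'
      simp only [Finset.mem_map, addRightEmbedding_apply] at hj'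
      obtain ⟨l, hl, rfl⟩ := hj'
      exact hts l hl hj
    have h2 : Disjoint (s ∪ t.map (addRightEmbedding 1)) (t.map (addRightEmbedding 2)) := by
      rw [Finset.disjoint_left]
      intro j hj hj'
      simp only [Finset.mem_map, addRightEmbedding_apply] at hj'
      obtain ⟨l, hl, rfl⟩ := hj'
      rcases Finset.mem_union.1 hj with hj | hj
      · exact hts' l hl hj
      · simp only [Finset.mem_map, addRightEmbedding_apply] at hj
        obtain ⟨l', hl', hll⟩ := hj
        have : l' = l + 1 := by linear_combination hll
        subst this
        exact htt l hl hl'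
    have h3 := Finset.card_le_univ
      ((s ∪ t.map (addRightEmbedding 1)) ∪ t.map (addRightEmbedding 2))
    rw [Finset.card_union_of_disjoint h2, Finset.card_union_of_disjoint h1, Finset.card_map,
      Finset.card_map, ZMod.card] at h3
    omega
  have k1 := key s t htt hts hts'
  have k2 := key t s hss hst hst'
  have h3 : h = 2 ∨ h = 3 := by omega
  rcases h3 with rfl | rfl
  · left
    refine ⟨rfl, fun j hj => ?_⟩
    have d : ∀ i j : ZMod (2 * 2), j ≠ i + 1 → i ≠ j + 1 → j ≠ i + 2 → j = i := by decide
    refine d i j ?_ ?_ ?_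
    · rintro rfl
      exact hst i hi hj
    · rintro rfl
      exact hts j hj hi
    · rintro rfl
      exact hst' i hi hj
  · right
    refine ⟨rfl, ?_⟩
    have d : ∀ i j : ZMod (2 * 3), j ≠ i + 1 → i ≠ j + 1 → j ≠ i + 2 → i ≠ j + 2 →
      j = i ∨ j = i + 3 := by decide
    have hsub : ∀ s t : Finset (ZMod (2 * 3)), 3 ≤ t.card + 1 → (∀ i ∈ s, i + 1 ∉ t) →
        (∀ i ∈ t, i + 1 ∉ s) → (∀ i ∈ s, i + 2 ∉ t) → (∀ i ∈ t, i + 2 ∉ s) → ∀ i ∈ s,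
        t = {i, i + 3} := by
      intro s t ht hst hts hst' hts' i hi
      refine Finset.eq_of_subset_of_card_le ?_ (Finset.card_le_two.trans (by omega))
      intro j hj
      rw [Finset.mem_insert, Finset.mem_singleton]
      refine d i j ?_ ?_ ?_ ?_
      · rintro rfl
        exact hst i hi hj
      · rintro rfl
        exact hts j hj hi
      · rintro rfl
        exact hst' i hi hj
      · rintro rfl
        exact hts' j hj hi
    have h1 := hsub s t ht hst hts hst' hts' i hi
    have h2 := hsub t s hs hts hst hts' hst' i (by simp [h1])
    intro j
    rw [h1, h2]
    simp

variable {V : Type*} {G : SimpleGraph V}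

/-- The edge `uw` replaces the `d` inner vertices of the arc from `c i` to `c (i + d + 1)`. -/
lemma CycleSeq.cons_cons {m : ℕ} {c : ZMod m → V} (hc : CycleSeq G m c) {u w : V}
    (hu : ∀ i, u ≠ c i) (hw : ∀ i, w ≠ c i) (huw : G.Adj u w) {i : ZMod m} (d : ℕ) (hd : d < m)
    (h1 : G.Adj u (c i)) (h2 : G.Adj w (c (i + (d + 1 : ℕ)))) :
    ∃ c' : ZMod (m - d + 2) → V, CycleSeq G (m - d + 2) c' := by
  have hp := (((hc.pathSeq (i + (d + 1 : ℕ))).mono (Nat.sub_le m d)).cat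
    ((pathSeq_one w).cons (v := u) (fun _ _ => huw.ne) huw) ?_ ?_)
  · refine ⟨_, hp.cycleSeq ?_⟩
    have e1 : ¬ (m - d + (1 + 1) - 1 < m - d) := by omega
    have e2 : ¬ (m - d + (1 + 1) - 1 - (m - d) < 1) := by omega
    have e3 : 0 < m - d := by omega
    simp only [PathForest.cat, e1, e2, e3, if_false, if_true]
    simpa using h2
  · intro s _ t _
    simp only [PathForest.cat]
    split_ifs
    · exact (hu _).symm
    · exact (hw _).symm
  · intro _ _
    have : i + ((d + 1 : ℕ) : ZMod m) + ((m - d - 1 : ℕ) : ZMod m) = i := by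
      rw [add_assoc, ← Nat.cast_add, show d + 1 + (m - d - 1) = m by omega, ZMod.natCast_self,
        add_zero]
    simp only [this, PathForest.cat]
    exact h1.symm

variable [Fintype V] [DecidableRel G.Adj] {h : ℕ}

/-- Each of `u`, `w` has its other neighbours on the cycle, at least `h - 1` of them. Any two such
neighbours, of the same or different ends, at distance `1`, and neighbours of different ends at
distance `2`, would give a cycle of length `2h + 1` or `2h + 2`; `residues_of_avoid` then applies.
-/
lemma adj_of_outside_edge (hG : G.Connected) (hδ : h ≤ G.minDegree) (hh : 2 ≤ h)
    (hmax : ∀ q g, PathSeq G q g → q ≤ 2 * h + 2) (hV : 2 * h + 2 < Fintype.card V)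
    (hno : ∀ c : ZMod (2 * h + 1) → V, ¬ CycleSeq G (2 * h + 1) c)
    {c : ZMod (2 * h) → V} (hc : CycleSeq G (2 * h) c) {u w : V} (hu : ∀ i, u ≠ c i)
    (hw : ∀ i, w ≠ c i) (huw : G.Adj u w) {i : ZMod (2 * h)} (hi : G.Adj u (c i)) :
    (h = 2 ∧ ∀ j, G.Adj w (c j) → j = i) ∨
      (h = 3 ∧ (∀ x, G.Adj u x ↔ x = w ∨ x = c i ∨ x = c (i + 3)) ∧
        ∀ x, G.Adj w x ↔ x = u ∨ x = c i ∨ x = c (i + 3)) := by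
  classical
  have : NeZero (2 * h) := ⟨by omega⟩
  have nbrs : ∀ u w i, (∀ i, u ≠ c i) → (∀ i, w ≠ c i) → G.Adj u w → G.Adj u (c i) →
      ∀ z, G.Adj w z → z ∈ ({u} : Finset V) ∨ ∃ i, z = c i := by
    intro u w i hu hw huw hi z hz
    by_contra! hcon
    rw [Finset.mem_singleton] at hcon
    have h1 := (hc.exists_pathSeq_cons hu hi).cons (v := w) (fun j _ => ?_) huw.symm
    · have := hmax _ _ (h1.cons (v := z) (fun j _ => ?_) hz.symm)
      · omega
      · simp only [cat]
        split_ifs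
        · exact hz.symm.ne
        · exact hcon.1
        · exact hcon.2 _
    · simp only [cat]
      split_ifs
      · exact huw.symm.ne
      · exact hw _
  have nw := nbrs u w i hu hw huw hi
  have cw := minDegree_le_card_add _ nw
  rw [Finset.card_singleton] at cw
  obtain ⟨j, hj⟩ := Finset.card_pos.1 (by omega : 0 < (cycleNbrs G c w).card)
  have nu := nbrs w u j hw hu huw.symm (mem_cycleNbrs.1 hj)
  have cu := minDegree_le_card_add _ nu
  rw [Finset.card_singleton] at cu
  have av1 : ∀ u, (∀ i, u ≠ c i) → ∀ i ∈ cycleNbrs G c u, i + 1 ∉ cycleNbrs G c u := by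
    intro u hu i hi hi'
    obtain ⟨c', hc'⟩ := hc.cons hu (mem_cycleNbrs.1 hi) (mem_cycleNbrs.1 hi')
    exact hno _ hc'
  -- Inserting the edge `uw` gives a `(2h + 2)`-cycle, which extends to a path that is too long.
  have av2 : ∀ u w, (∀ i, u ≠ c i) → (∀ i, w ≠ c i) → G.Adj u w → ∀ i ∈ cycleNbrs G c u,
      i + 1 ∉ cycleNbrs G c w := by
    intro u w hu hw huw i hi hi'
    obtain ⟨c', hc'⟩ := hc.cons_cons hu hw huw 0 (by omega) (mem_cycleNbrs.1 hi)
      (by simpa using mem_cycleNbrs.1 hi')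
    obtain ⟨g, hg⟩ := hc'.exists_longer hG (by omega)
    have := hmax _ _ hg
    omega
  -- Here `uw` replaces a single cycle vertex and produces the excluded `(2h + 1)`-cycle.
  have av3 : ∀ u w, (∀ i, u ≠ c i) → (∀ i, w ≠ c i) → G.Adj u w → ∀ i ∈ cycleNbrs G c u,
      i + 2 ∉ cycleNbrs G c w := by
    intro u w hu hw huw i hi hi'
    have h1 := hc.cons_cons hu hw huw 1 (by omega) (mem_cycleNbrs.1 hi)
      (by simpa [one_add_one_eq_two] using mem_cycleNbrs.1 hi')
    rw [show 2 * h - 1 + 2 = 2 * h + 1 by omega] at h1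
    obtain ⟨c', hc'⟩ := h1
    exact hno _ hc'
  have := residues_of_avoid hh (cycleNbrs G c u) (cycleNbrs G c w) (by omega) (by omega)
    (av1 u hu) (av1 w hw) (av2 u w hu hw huw) (av2 w u hw hu huw.symm) (av3 u w hu hw huw)
    (av3 w u hw hu huw.symm) i (mem_cycleNbrs.2 hi)
  refine this.imp (And.imp_right fun h1 j hj => h1 j (mem_cycleNbrs.2 hj))
    (And.imp_right fun h1 => ?_)
  simp only [mem_cycleNbrs] at h1
  have conv : ∀ u w, G.Adj u w → (∀ z, G.Adj u z → z ∈ ({w} : Finset V) ∨ ∃ i, z = c i) →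
      (∀ j, G.Adj u (c j) ↔ j = i ∨ j = i + 3) →
      ∀ x, G.Adj u x ↔ x = w ∨ x = c i ∨ x = c (i + 3) := by
    intro u w huw hn hu x
    constructor
    · intro hx
      rcases hn x hx with h2 | ⟨j, rfl⟩
      · exact Or.inl (Finset.mem_singleton.1 h2)
      · rcases (hu j).1 hx with rfl | rfl <;> tauto
    · rintro (rfl | rfl | rfl)
      · exact huw
      · exact (hu _).2 (Or.inl rfl)
      · exact (hu _).2 (Or.inr rfl)
  exact ⟨conv u w huw nu fun j => (h1 j).1, conv w u huw.symm nw fun j => (h1 j).2⟩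

end OutsideEdge

/-! ### The case `h = 3`: all of `G` consists of triangles' bases over two hubs. -/

section SixCycle

variable {V : Type*} {G : SimpleGraph V}

lemma cycleSeq_six {x : ZMod 6 → V} (hx : Function.Injective x) (h0 : G.Adj (x 0) (x 1))
    (h1 : G.Adj (x 1) (x 2)) (h2 : G.Adj (x 2) (x 3)) (h3 : G.Adj (x 3) (x 4))
    (h4 : G.Adj (x 4) (x 5)) (h5 : G.Adj (x 5) (x 0)) : CycleSeq G 6 x := by
  refine ⟨hx, fun i => ?_⟩
  have d : ∀ i : ZMod 6, i = 0 ∧ i + 1 = 1 ∨ i = 1 ∧ i + 1 = 2 ∨ i = 2 ∧ i + 1 = 3 ∨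
      i = 3 ∧ i + 1 = 4 ∨ i = 4 ∧ i + 1 = 5 ∨ i = 5 ∧ i + 1 = 0 := by decide
  rcases d i with ⟨e, e'⟩ | ⟨e, e'⟩ | ⟨e, e'⟩ | ⟨e, e'⟩ | ⟨e, e'⟩ | ⟨e, e'⟩ <;>
    rw [e', e] <;> assumption

variable [Fintype V] [DecidableRel G.Adj]

/-- The hubs are `c 0` and `c 3`. Exchanging `uw` with either of the arcs `c 1, c 2` and `c 5, c 4`
gives new 6-cycles, so these arcs are attached exactly as `uw` is; connectivity carries the pattern
to every vertex. -/
lemma exists_partner_of_six_cycle (hG : G.Connected) (hδ : 3 ≤ G.minDegree)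
    (hmax : ∀ q g, PathSeq G q g → q ≤ 8) (hV : 8 < Fintype.card V)
    (hno : ∀ c : ZMod 7 → V, ¬ CycleSeq G 7 c)
    {c : ZMod 6 → V} (hc : CycleSeq G 6 c) {u w : V} (hu : ∀ i, u ≠ c i)
    (hw : ∀ i, w ≠ c i) (huw : G.Adj u w) (h0 : G.Adj u (c 0)) (v : V) :
    v = c 0 ∨ v = c 3 ∨ ∃ v', (∀ x, G.Adj v x ↔ x = v' ∨ x = c 0 ∨ x = c 3) ∧
      ∀ x, G.Adj v' x ↔ x = v ∨ x = c 0 ∨ x = c 3 := by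
  have key : ∀ (c : ZMod 6 → V), CycleSeq G 6 c → ∀ u w, (∀ i, u ≠ c i) → (∀ i, w ≠ c i) →
      G.Adj u w → ∀ i, G.Adj u (c i) → (∀ x, G.Adj u x ↔ x = w ∨ x = c i ∨ x = c (i + 3)) ∧
        ∀ x, G.Adj w x ↔ x = u ∨ x = c i ∨ x = c (i + 3) := by
    intro c hc u w hu hw huw i hi
    rcases adj_of_outside_edge (h := 3) hG hδ (by norm_num) hmax hV hno hc hu hw huw hi with h1 | h1
    · omega
    · exact h1.2
  have kuw := key c hc u w hu hw huw 0 h0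
  rw [zero_add] at kuw
  have a01 := hc.adj 0
  have a12 := hc.adj 1
  have a23 := hc.adj 2
  have a34 := hc.adj 3
  have a45 := hc.adj 4
  have a50 := hc.adj 5
  rw [show (0 : ZMod 6) + 1 = 1 by decide] at a01
  rw [show (1 : ZMod 6) + 1 = 2 by decide] at a12
  rw [show (2 : ZMod 6) + 1 = 3 by decide] at a23
  rw [show (3 : ZMod 6) + 1 = 4 by decide] at a34
  rw [show (4 : ZMod 6) + 1 = 5 by decide] at a45
  rw [show (5 : ZMod 6) + 1 = 0 by decide] at a50
  have ne : ∀ i j, i ≠ j → c i ≠ c j := fun i j hij => hc.inj.ne hij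
  have u3 : G.Adj u (c 3) := (kuw.1 _).2 (by simp)
  have w3 : G.Adj w (c 3) := (kuw.2 _).2 (by simp)
  have w0 : G.Adj w (c 0) := (kuw.2 _).2 (by simp)
  have k12 : (∀ x, G.Adj (c 1) x ↔ x = c 2 ∨ x = c 0 ∨ x = c 3) ∧
      ∀ x, G.Adj (c 2) x ↔ x = c 1 ∨ x = c 0 ∨ x = c 3 := by
    have inj : Function.Injective (![c 0, u, w, c 3, c 4, c 5] : Fin 6 → V) := by
      rw [← List.nodup_ofFn]
      simp [hu, hw, huw.ne, hc.inj.eq_iff, fun i => (hu i).symm, fun i => (hw i).symm]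
      decide
    have hc' : CycleSeq G 6 (![c 0, u, w, c 3, c 4, c 5] : Fin 6 → V) :=
      cycleSeq_six inj h0.symm huw w3 a34 a45 a50
    have h1 : ∀ i, c 1 ≠ (![c 0, u, w, c 3, c 4, c 5] : Fin 6 → V) i := by
      intro i
      fin_cases i
      exacts [ne _ _ (by decide), (hu _).symm, (hw _).symm, ne _ _ (by decide),
        ne _ _ (by decide), ne _ _ (by decide)]
    have h2 : ∀ i, c 2 ≠ (![c 0, u, w, c 3, c 4, c 5] : Fin 6 → V) i := by
      intro i
      fin_cases i
      exacts [ne _ _ (by decide), (hu _).symm, (hw _).symm, ne _ _ (by decide),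
        ne _ _ (by decide), ne _ _ (by decide)]
    exact key _ hc' (c 1) (c 2) h1 h2 a12 0 a01.symm
  have k54 : (∀ x, G.Adj (c 5) x ↔ x = c 4 ∨ x = c 0 ∨ x = c 3) ∧
      ∀ x, G.Adj (c 4) x ↔ x = c 5 ∨ x = c 0 ∨ x = c 3 := by
    have inj : Function.Injective (![c 0, u, w, c 3, c 2, c 1] : Fin 6 → V) := by
      rw [← List.nodup_ofFn]
      simp [hu, hw, huw.ne, hc.inj.eq_iff, fun i => (hu i).symm, fun i => (hw i).symm]
      decide
    have hc' : CycleSeq G 6 (![c 0, u, w, c 3, c 2, c 1] : Fin 6 → V) :=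
      cycleSeq_six inj h0.symm huw w3 a23.symm a12.symm a01.symm
    have h1 : ∀ i, c 5 ≠ (![c 0, u, w, c 3, c 2, c 1] : Fin 6 → V) i := by
      intro i
      fin_cases i
      exacts [ne _ _ (by decide), (hu _).symm, (hw _).symm, ne _ _ (by decide),
        ne _ _ (by decide), ne _ _ (by decide)]
    have h2 : ∀ i, c 4 ≠ (![c 0, u, w, c 3, c 2, c 1] : Fin 6 → V) i := by
      intro i
      fin_cases i
      exacts [ne _ _ (by decide), (hu _).symm, (hw _).symm, ne _ _ (by decide),
        ne _ _ (by decide), ne _ _ (by decide)]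
    exact key _ hc' (c 5) (c 4) h1 h2 a45.symm 0 a50
  have near : ∀ y i, i = 0 ∨ i = 3 → G.Adj y (c i) →
      y = c 0 ∨ y = c 3 ∨ ∃ v', (∀ x, G.Adj y x ↔ x = v' ∨ x = c 0 ∨ x = c 3) ∧
      ∀ x, G.Adj v' x ↔ x = y ∨ x = c 0 ∨ x = c 3 := by
    intro y i hi hy
    by_cases hyc : ∀ j, y ≠ c j
    · right; right
      by_cases hy' : ∃ y', G.Adj y y' ∧ ∀ j, y' ≠ c j
      · obtain ⟨y', h1, h2⟩ := hy'
        have := key c hc y y' hyc h2 h1 i hy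
        rcases hi with rfl | rfl
        · rw [zero_add] at this
          exact ⟨y', this⟩
        · rw [show (3 : ZMod 6) + 3 = 0 by decide] at this
          refine ⟨y', fun x => ?_, fun x => ?_⟩
          · rw [this.1]
            tauto
          · rw [this.2]
            tauto
      · push Not at hy'
        -- Without a neighbour off the cycle, `y` is adjacent to `c 0` and `c 3` at most, against
        -- degree at least `3`.
        exfalso
        have h1 := minDegree_le_card_add (c := c) (y := y) ∅ fun z hz => Or.inr (hy' z hz)
        have h2 : cycleNbrs G c y ⊆ {0, 3} := by
          intro j hj
          rw [mem_cycleNbrs] at hj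
          have d : ∀ j : ZMod 6, j = 0 ∨ j = 3 ∨ j = 1 ∨ j = 2 ∨ j = 4 ∨ j = 5 := by decide
          rw [Finset.mem_insert, Finset.mem_singleton]
          rcases d j with rfl | rfl | rfl | rfl | rfl | rfl
          · simp
          · simp
          · exact absurd ((k12.1 y).1 hj.symm) (by simp [hyc])
          · exact absurd ((k12.2 y).1 hj.symm) (by simp [hyc])
          · exact absurd ((k54.2 y).1 hj.symm) (by simp [hyc])
          · exact absurd ((k54.1 y).1 hj.symm) (by simp [hyc])
        have h3 := (Finset.card_le_card h2).trans Finset.card_le_two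
        rw [Finset.card_empty] at h1
        omega
    · push Not at hyc
      obtain ⟨j, rfl⟩ := hyc
      have d : ∀ j : ZMod 6, j = 0 ∨ j = 3 ∨ j = 1 ∨ j = 2 ∨ j = 4 ∨ j = 5 := by decide
      rcases d j with rfl | rfl | rfl | rfl | rfl | rfl
      · simp
      · simp
      · exact Or.inr (Or.inr ⟨c 2, k12⟩)
      · exact Or.inr (Or.inr ⟨c 1, k12.symm⟩)
      · exact Or.inr (Or.inr ⟨c 5, k54.symm⟩)
      · exact Or.inr (Or.inr ⟨c 4, k54⟩)
  refine eq_univ_of_connected hG {v | v = c 0 ∨ v = c 3 ∨ ∃ v',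
    (∀ x, G.Adj v x ↔ x = v' ∨ x = c 0 ∨ x = c 3) ∧
      ∀ x, G.Adj v' x ↔ x = v ∨ x = c 0 ∨ x = c 3} (c 0) (Or.inl rfl) ?_ v
  rintro x (rfl | rfl | ⟨v', h1, h2⟩) y hxy
  · exact near y 0 (Or.inl rfl) hxy.symm
  · exact near y 3 (Or.inr rfl) hxy.symm
  · rcases (h1 y).1 hxy with rfl | rfl | rfl
    · exact Or.inr (Or.inr ⟨x, h2, h1⟩)
    · exact Or.inl rfl
    · exact Or.inr (Or.inl rfl)

end SixCycle

/-! ### Recognising `L_{t,h}` and `K_2 ∨ tK_2`. -/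

section Clusters

variable {V : Type*} [Fintype V] {G : SimpleGraph V}

lemma copies_K_adj {t h : ℕ} {x y : Σ _ : Fin t, Fin h} :
    (copies t (K h)).Adj x y ↔ x.1 = y.1 ∧ x ≠ y := by
  constructor
  · rintro ⟨i, u, v, huv, rfl, rfl⟩
    refine ⟨rfl, fun hxy => huv.ne ?_⟩
    rw [Sigma.mk.injEq] at hxy
    exact eq_of_heq hxy.2
  · obtain ⟨i, u⟩ := x
    obtain ⟨j, v⟩ := y
    rintro ⟨h1, h2⟩
    obtain rfl : i = j := h1
    refine ⟨i, u, v, ?_, rfl, rfl⟩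
    intro huv
    obtain rfl : u = v := huv
    exact h2 rfl

/-- If deleting `Z` leaves disjoint cliques of order `h`, then `G - Z` is `t K_h`. -/
lemma exists_equiv_copies [DecidableEq V] (Z : Finset V) (h : ℕ)
    (htrans : ∀ x y z, x ∉ Z → y ∉ Z → z ∉ Z → G.Adj x y → G.Adj y z → x ≠ z → G.Adj x z)
    (hcard : ∀ x, x ∉ Z → ∃ s : Finset V, s.card = h ∧ ∀ y, y ∈ s ↔ y ∉ Z ∧ (x = y ∨ G.Adj x y)) :
    ∃ t, Fintype.card V = t * h + Z.card ∧ ∃ e : {v // v ∉ Z} ≃ Σ _ : Fin t, Fin h,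
      ∀ x y : {v // v ∉ Z}, G.Adj x.1 y.1 ↔ (copies t (K h)).Adj (e x) (e y) := by
  classical
  let S : Setoid {v // v ∉ Z} :=
    { r := fun x y => x.1 = y.1 ∨ G.Adj x.1 y.1
      iseqv :=
        { refl := fun x => Or.inl rfl
          symm := fun h => h.imp Eq.symm fun h => h.symm
          trans := by
            rintro ⟨x, hx⟩ ⟨y, hy⟩ ⟨z, hz⟩ h1 h2
            dsimp only at h1 h2 ⊢
            rcases h1 with rfl | h1
            · exact h2
            rcases h2 with rfl | h2
            · exact Or.inr h1
            by_cases hxz : x = z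
            · exact Or.inl hxz
            · exact Or.inr (htrans x y z hx hy hz h1 h2 hxz) } }
  let Q := Quotient S
  have fib : ∀ q : Q, Nonempty ({x : {v // v ∉ Z} // Quotient.mk S x = q} ≃ Fin h) := by
    intro q
    induction q using Quotient.inductionOn with
    | h x =>
      obtain ⟨s, hs, hs'⟩ := hcard x.1 x.2
      have e : {x' : {v // v ∉ Z} // Quotient.mk S x' = Quotient.mk S x} ≃ {v // v ∈ s} :=
        { toFun := fun y => ⟨y.1.1, (hs' _).2 ⟨y.1.2, Quotient.exact y.2.symm⟩⟩
          invFun := fun y => ⟨⟨y.1, ((hs' _).1 y.2).1⟩, (Quotient.sound ((hs' _).1 y.2).2 :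
            Quotient.mk S x = Quotient.mk S ⟨y.1, ((hs' _).1 y.2).1⟩).symm⟩
          left_inv := fun y => rfl
          right_inv := fun y => rfl }
      exact ⟨e.trans (Fintype.equivFinOfCardEq (by simpa using hs))⟩
  let e : {v // v ∉ Z} ≃ Σ _ : Fin (Fintype.card Q), Fin h :=
    (Equiv.sigmaFiberEquiv (Quotient.mk S)).symm.trans
      (Equiv.sigmaCongr (Fintype.equivFin Q) fun q => (fib q).some)
  have he : ∀ x, (e x).1 = Fintype.equivFin Q (Quotient.mk S x) := fun x => rfl
  refine ⟨Fintype.card Q, ?_, e, fun x y => ?_⟩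
  · have h1 := Fintype.card_congr e
    rw [Fintype.card_sigma] at h1
    simp only [Fintype.card_fin, Finset.sum_const, Finset.card_univ, smul_eq_mul] at h1
    rw [← h1, Fintype.card_subtype_compl]
    have := Finset.card_le_univ Z
    simp
    omega
  · rw [copies_K_adj, he, he, e.injective.ne_iff, (Fintype.equivFin Q).injective.eq_iff]
    have : Quotient.mk S x = Quotient.mk S y ↔ x.1 = y.1 ∨ G.Adj x.1 y.1 :=
      ⟨fun h => Quotient.exact h, fun h => Quotient.sound h⟩
    rw [this]
    constructor
    · intro h1
      exact ⟨Or.inr h1, fun h2 => h1.ne (congrArg Subtype.val h2)⟩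
    · rintro ⟨h1, h2⟩
      exact h1.resolve_left fun h3 => h2 (Subtype.ext h3)

lemma nonempty_iso_L [DecidableEq V] (c : V) (h : ℕ) (hc : ∀ x, x ≠ c → G.Adj c x)
    (htrans : ∀ x y z, x ≠ c → y ≠ c → z ≠ c → G.Adj x y → G.Adj y z → x ≠ z → G.Adj x z)
    (hcard : ∀ x, x ≠ c → ∃ s : Finset V, s.card = h ∧ ∀ y, y ∈ s ↔ y ≠ c ∧ (x = y ∨ G.Adj x y)) :
    ∃ t, Fintype.card V = t * h + 1 ∧ Nonempty (G ≃g L t h) := by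
  obtain ⟨t, ht, e, he⟩ := exists_equiv_copies (G := G) {c} h
    (by simpa only [Finset.mem_singleton] using htrans)
    (by simpa only [Finset.mem_singleton] using hcard)
  refine ⟨t, by simpa using ht, ?_⟩
  have e1 : {x // x ∈ ({c} : Finset V)} ≃ Fin 1 := Fintype.equivFinOfCardEq (by simp)
  let φ := (Equiv.sumCompl (· ∈ ({c} : Finset V))).symm.trans (Equiv.sumCongr e1 e)
  refine ⟨⟨φ, ?_⟩⟩
  intro x y
  by_cases hx : x ∈ ({c} : Finset V) <;> by_cases hy : y ∈ ({c} : Finset V)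
  · rw [Finset.mem_singleton] at hx hy
    subst hx hy
    simp
  · have : G.Adj x y := by
      rw [Finset.mem_singleton] at hx hy
      exact hx ▸ hc y hy
    simp only [this, iff_true]
    simp [φ, Equiv.sumCompl_symm_apply_of_pos hx, Equiv.sumCompl_symm_apply_of_neg hy, L, join]
  · have : G.Adj x y := by
      rw [Finset.mem_singleton] at hx hy
      exact hy ▸ (hc x hx).symm
    simp only [this, iff_true]
    simp [φ, Equiv.sumCompl_symm_apply_of_pos hy, Equiv.sumCompl_symm_apply_of_neg hx, L, join]
  · refine Iff.trans ?_ (he ⟨x, hx⟩ ⟨y, hy⟩).symm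
    simp [φ, Equiv.sumCompl_symm_apply_of_neg hy, Equiv.sumCompl_symm_apply_of_neg hx, L, join]

/-- Containment rather than isomorphism, because `z` and `z'` may be non-adjacent. -/
lemma isContained_join_copies_K_two [DecidableEq V] {n : ℕ} (hn : Fintype.card V = n) (z z' : V)
    (hz : z ≠ z') (hp : ∀ v, v = z ∨ v = z' ∨ ∃ v', (∀ x, G.Adj v x ↔ x = v' ∨ x = z ∨ x = z') ∧
      ∀ x, G.Adj v' x ↔ x = v ∨ x = z ∨ x = z') :
    Even n ∧ G ⊑ join (K 2) (copies ((n - 2) / 2) (K 2)) := by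
  have mem : ∀ v, v ∉ ({z, z'} : Finset V) → v ≠ z ∧ v ≠ z' ∧
      ∃ v', v' ∉ ({z, z'} : Finset V) ∧ (∀ x, G.Adj v x ↔ x = v' ∨ x = z ∨ x = z') ∧
      ∀ x, G.Adj v' x ↔ x = v ∨ x = z ∨ x = z' := by
    intro v hv
    simp only [Finset.mem_insert, Finset.mem_singleton, not_or] at hv
    obtain ⟨v', h1, h2⟩ := ((hp v).resolve_left hv.1).resolve_left hv.2
    refine ⟨hv.1, hv.2, v', ?_, h1, h2⟩
    simp only [Finset.mem_insert, Finset.mem_singleton, not_or]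
    constructor
    · rintro rfl
      exact G.loopless.irrefl v' ((h2 v').2 (by simp))
    · rintro rfl
      exact G.loopless.irrefl v' ((h2 v').2 (by simp))
  obtain ⟨t, ht, e, he⟩ := exists_equiv_copies (G := G) {z, z'} 2
    (by
      intro x y w hx hy hw hxy hyw hxw
      obtain ⟨-, -, v, hv, h1, h2⟩ := mem y hy
      simp only [Finset.mem_insert, Finset.mem_singleton, not_or] at hx hw
      have h3 := ((h1 x).1 hxy.symm).resolve_right (by tauto)
      have h4 := ((h1 w).1 hyw).resolve_right (by tauto)
      exact absurd (h3.trans h4.symm) hxw)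
    (by
      intro x hx
      obtain ⟨h1, h2, v, hv, h3, h4⟩ := mem x hx
      refine ⟨{x, v}, Finset.card_pair ((h3 v).2 (by simp)).ne, fun y => ?_⟩
      rw [h3]
      simp only [Finset.mem_insert, Finset.mem_singleton, not_or] at hv ⊢
      constructor
      · rintro (rfl | rfl) <;> tauto
      · tauto)
  rw [Finset.card_pair hz, hn] at ht
  have ht' : (n - 2) / 2 = t := by omega
  refine ⟨⟨t + 1, by omega⟩, ?_⟩
  rw [ht']
  have e1 : {x // x ∈ ({z, z'} : Finset V)} ≃ Fin 2 :=
    Fintype.equivFinOfCardEq ((Fintype.card_coe _).trans (Finset.card_pair hz))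
  let φ := (Equiv.sumCompl (· ∈ ({z, z'} : Finset V))).symm.trans (Equiv.sumCongr e1 e)
  refine ⟨⟨⟨φ, ?_⟩, φ.injective⟩⟩
  intro x y hxy
  by_cases hx : x ∈ ({z, z'} : Finset V) <;> by_cases hy : y ∈ ({z, z'} : Finset V)
  · simp only [φ, Equiv.trans_apply, Equiv.sumCompl_symm_apply_of_pos hx,
      Equiv.sumCompl_symm_apply_of_pos hy]
    simpa [join] using hxy.ne
  · simp [φ, Equiv.sumCompl_symm_apply_of_pos hx, Equiv.sumCompl_symm_apply_of_neg hy, join]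
  · simp [φ, Equiv.sumCompl_symm_apply_of_pos hy, Equiv.sumCompl_symm_apply_of_neg hx, join]
  · have := (he ⟨x, hx⟩ ⟨y, hy⟩).1 hxy
    simpa [φ, Equiv.sumCompl_symm_apply_of_neg hy, Equiv.sumCompl_symm_apply_of_neg hx, join]
      using this

end Clusters

/-! ### Embedding the forest when `h = 3`, by explicit lists of vertices. -/

section ExplicitPaths

variable {V : Type*} {G : SimpleGraph V} {k : ℕ} {a : Fin k → ℕ} {b : ℕ}

lemma pathSeq_getD (l : List V) (d : V) (hn : l.Nodup) (hc : l.IsChain G.Adj) :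
    PathSeq G l.length (fun i => l.getD i d) := by
  constructor
  · intro i j hi hj hij
    rw [List.getD_eq_getElem _ _ hi, List.getD_eq_getElem _ _ hj] at hij
    exact (List.Nodup.getElem_inj_iff hn).1 hij
  · intro i hi
    rw [List.getD_eq_getElem _ _ hi, List.getD_eq_getElem _ _ (by omega : i < l.length)]
    exact List.isChain_iff_getElem.1 hc i hi

lemma forest_isContained_of_two_lists (l l' : List V) (hn : (l ++ l').Nodup)
    (hc : l.IsChain G.Adj) (hc' : l'.IsChain G.Adj) (I : Finset (Option (Fin k)))
    (hp : ∑ i ∈ I, orders a b i ≤ l.length) (hq : ∑ i ∈ Iᶜ, orders a b i ≤ l'.length) :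
    forest a b ⊑ G := by
  have hd := List.disjoint_of_nodup_append hn
  have hpos : 0 < l.length + l'.length := by
    have := sum_orders a b
    rw [← Finset.sum_add_sum_compl I] at this
    omega
  rw [← List.length_append] at hpos
  -- Any vertex will do as the default of `getD`; the lists are not both empty, as the forest has a
  -- positive number of vertices.
  have d := (l ++ l')[0]
  refine forest_isContained_of_two_paths (pathSeq_getD l d hn.of_append_left hc)
    (pathSeq_getD l' d hn.of_append_right hc') ?_ I hp hq
  intro i hi j hj hij
  rw [List.getD_eq_getElem _ _ hi, List.getD_eq_getElem _ _ hj] at hij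
  exact hd (List.getElem_mem hi) (hij ▸ List.getElem_mem hj)

variable [Fintype V] [DecidableRel G.Adj]

/-- The forest has `9` vertices. Apart from `P_6 ∪ P_3`, either it has a component `P_2`, and `2 +
7` vertices on two paths suffice, or it is `P_4 ∪ P_5`. -/
lemma forest_isContained_or_of_six_cycle {n : ℕ} (hn : Fintype.card V = n) (hk : 1 ≤ k)
    (ha : ∀ i, 1 ≤ a i) (hb : 1 ≤ b) (hh : 4 = (∑ i, a i) + b)
    (hG : G.Connected) (hδ : 3 ≤ G.minDegree)
    (hmax : ∀ q g, PathSeq G q g → q ≤ 8) (hV : 8 < n)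
    (hno : ∀ c : ZMod 7 → V, ¬ CycleSeq G 7 c)
    {c : ZMod 6 → V} (hc : CycleSeq G 6 c) {u w : V} (hu : ∀ i, u ≠ c i)
    (hw : ∀ i, w ≠ c i) (huw : G.Adj u w) {i : ZMod 6} (hi : G.Adj u (c i)) :
    forest a b ⊑ G ∨ Nonempty (forest a b ≃g (pathGraph 6 ⊕g pathGraph 3)) ∧ Even n ∧
        G ⊑ join (K 2) (copies ((n - 2) / 2) (K 2)) := by
  classical
  wlog hi0 : i = 0 generalizing c i
  · have hc' : CycleSeq G 6 (fun j => c (i + j)) :=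
      ⟨fun j l hjl => add_left_cancel (hc.inj hjl), fun j => by
        have := hc.adj (i + j)
        rwa [add_assoc] at this⟩
    exact this (i := 0) hc' (fun _ => hu _) (fun _ => hw _) (by simpa using hi) rfl
  subst hi0
  have part := exists_partner_of_six_cycle hG hδ hmax (hn.symm ▸ hV) hno hc hu hw huw hi
  have fin := isContained_join_copies_K_two hn (c 0) (c 3) (hc.inj.ne (by decide)) part
  by_cases hex : k = 1 ∧ b = 1
  · obtain ⟨rfl, rfl⟩ := hex
    refine Or.inr ⟨nonempty_forest_iso (m := 3) rfl fun i => ?_, fin⟩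
    rw [Fin.sum_univ_one] at hh
    obtain rfl : i = 0 := Subsingleton.elim _ _
    omega
  left
  have a01 := hc.adj 0
  have a12 := hc.adj 1
  have a45 := hc.adj 4
  have a34 := hc.adj 3
  rw [show (0 : ZMod 6) + 1 = 1 by decide] at a01
  rw [show (1 : ZMod 6) + 1 = 2 by decide] at a12
  rw [show (3 : ZMod 6) + 1 = 4 by decide] at a34
  rw [show (4 : ZMod 6) + 1 = 5 by decide] at a45
  have full : ∀ v, v ≠ c 0 → v ≠ c 3 → G.Adj v (c 0) ∧ G.Adj v (c 3) := by
    intro v h1 h2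
    obtain ⟨v', h3, -⟩ := ((part v).resolve_left h1).resolve_left h2
    exact ⟨(h3 _).2 (by simp), (h3 _).2 (by simp)⟩
  have uniq : ∀ v x y, v ≠ c 0 → v ≠ c 3 → x ≠ c 0 → x ≠ c 3 → y ≠ c 0 → y ≠ c 3 →
      G.Adj v x → G.Adj v y → x = y := by
    intro v x y h1 h2 hx hx' hy hy' h3 h4
    obtain ⟨v', h5, -⟩ := ((part v).resolve_left h1).resolve_left h2
    rw [((h5 x).1 h3).resolve_right (by tauto), ((h5 y).1 h4).resolve_right (by tauto)]
  obtain ⟨y, hy⟩ : ∃ y, y ∉ insert u (insert w (Finset.univ.image c)) := by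
    by_contra! hcon
    have h1 := Finset.card_le_card (fun x _ => hcon x :
      Finset.univ ⊆ insert u (insert w (Finset.univ.image c)))
    have h2 := Finset.card_insert_le u (insert w (Finset.univ.image c))
    have h3 := Finset.card_insert_le w (Finset.univ.image c)
    have h4 := Finset.card_image_le (s := Finset.univ) (f := c)
    simp only [Finset.card_univ, ZMod.card] at h1 h4
    omega
  simp only [Finset.mem_insert, Finset.mem_image, Finset.mem_univ, true_and, not_or,
    not_exists] at hy
  obtain ⟨hyu, hyw, hyc⟩ := hy
  have hyc' : ∀ i, y ≠ c i := fun i => Ne.symm (hyc i)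
  have hu' : ∀ i, c i ≠ u := fun i => (hu i).symm
  have hw' : ∀ i, c i ≠ w := fun i => (hw i).symm
  have nd : ∀ i j : ZMod 6, i ≠ j → c i ≠ c j := fun i j hij => hc.inj.ne hij
  by_cases ha1 : ∃ i, a i = 1
  · obtain ⟨i, hi1⟩ := ha1
    -- The pair `y y'` hosts `P_2`; since partners are unique, `y'` avoids the seven-vertex path
    -- through both hubs.
    obtain ⟨y', h1, h2⟩ := ((part y).resolve_left (hyc' 0)).resolve_left (hyc' 3)
    have hyy : G.Adj y y' := (h1 _).2 (by simp)
    have hy0 : y' ≠ c 0 := by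
      rintro rfl
      exact G.loopless.irrefl _ ((h2 (c 0)).2 (by simp))
    have hy3 : y' ≠ c 3 := by
      rintro rfl
      exact G.loopless.irrefl _ ((h2 (c 3)).2 (by simp))
    have avoid : ∀ x x', x ≠ c 0 → x ≠ c 3 → x' ≠ c 0 → x' ≠ c 3 → G.Adj x x' → y ≠ x' →
        y' ≠ x := by
      rintro x x' hx hx3 hx0' hx3' hxx hyx rfl
      exact hyx (uniq y' y x' hx hx3 (hyc' 0) (hyc' 3) hx0' hx3' hyy.symm hxx)
    refine forest_isContained_of_two_lists [y, y'] [c 1, c 2, c 0, u, w, c 3, c 4] ?_ ?_ ?_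
      {some i} (by simp [orders, hi1]) ?_
    · have e1 := avoid (c 1) (c 2) (nd _ _ (by decide)) (nd _ _ (by decide)) (nd _ _ (by decide))
        (nd _ _ (by decide)) a12 (hyc' _)
      have e2 := avoid (c 2) (c 1) (nd _ _ (by decide)) (nd _ _ (by decide)) (nd _ _ (by decide))
        (nd _ _ (by decide)) a12.symm (hyc' _)
      have e3 := avoid (c 4) (c 5) (nd _ _ (by decide)) (nd _ _ (by decide)) (nd _ _ (by decide))
        (nd _ _ (by decide)) a45 (hyc' _)
      have e4 := avoid u w (hu _) (hu _) (hw _) (hw _) huw hyw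
      have e5 := avoid w u (hw _) (hw _) (hu _) (hu _) huw.symm hyu
      simp [hyy.ne, hyu, hyw, hyc', hu, hw, hu', hw', huw.ne, hy0, hy3, e1, e2, e3, e4, e5,
        hc.inj.eq_iff]
      decide
    · simpa using hyy
    · simp only [List.isChain_cons_cons, List.isChain_singleton, and_true]
      exact ⟨a12, (full _ (nd _ _ (by decide)) (nd _ _ (by decide))).1,
        (full _ (hu _) (hu _)).1.symm, huw, (full _ (hw _) (hw _)).2, a34⟩
    · have := sum_orders a b
      rw [← Finset.sum_add_sum_compl {some i}, Finset.sum_singleton] at this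
      simp only [orders, hi1] at this
      simp only [List.length_cons, List.length_nil]
      simp only [orders]
      omega
  · have ha2 : ∀ i, 2 ≤ a i := fun i => by
      have := ha i
      have : a i ≠ 1 := fun h => ha1 ⟨i, h⟩
      omega
    have hsum : k * 2 ≤ ∑ i, a i := by
      simpa using Finset.sum_le_sum (s := Finset.univ) fun i _ => ha2 i
    refine forest_isContained_of_two_lists [u, w, c 0, c 1, c 2] [c 5, c 4, c 3, y] ?_ ?_ ?_
      {none} (by simp [orders]; omega) ?_
    · simp [Ne.symm hyu, Ne.symm hyw, hyc, hu, hw, huw.ne, hc.inj.eq_iff]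
      decide
    · simp only [List.isChain_cons_cons, List.isChain_singleton, and_true]
      exact ⟨huw, (full _ (hw _) (hw _)).1, a01, a12⟩
    · simp only [List.isChain_cons_cons, List.isChain_singleton, and_true]
      exact ⟨a45.symm, a34.symm, (full _ (hyc' _) (hyc' _)).2.symm⟩
    · have := sum_orders a b
      rw [← Finset.sum_add_sum_compl {none}, Finset.sum_singleton] at this
      simp only [orders] at this
      simp only [List.length_cons, List.length_nil]
      simp only [orders]
      omega

end ExplicitPaths

/-! ### End neighbourhoods, chords and extensions of a longest path. -/

section LongestPath

variable {V : Type*} {G : SimpleGraph V} {p : ℕ} {f : ℕ → V}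

lemma PathSeq.shift_rev {q s : ℕ} (hf : PathSeq G p f) (hs : s < p) (hq : q ≤ s + 1) :
    PathSeq G q (fun i => f (s - i)) :=
  ⟨fun hi hj hij => by have := hf.inj (by omega) (by omega) hij; omega,
    fun hi => hf.adj_of (by omega) (by omega) (by omega)⟩

lemma PathSeq.exists_eq_of_adj_zero (hf : PathSeq G p f) (hmax : ∀ q g, PathSeq G q g → q ≤ p)
    {x : V} (hx : G.Adj (f 0) x) : ∃ i < p, x = f i := by
  by_contra! hcon
  have := hmax _ _ (hf.cons hcon hx.symm)
  omega

/-- Reversing the initial segment up to `f i`, where `f 0` is adjacent to `f (i + 1)`. -/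
lemma PathSeq.exists_eq_of_adj_rotate (hf : PathSeq G p f)
    (hmax : ∀ q g, PathSeq G q g → q ≤ p) {i : ℕ} (hi : i + 1 < p) (h0 : G.Adj (f 0) (f (i + 1)))
    {x : V} (hx : G.Adj (f i) x) : ∃ j < p, x = f j := by
  have h1 := (hf.shift_rev (q := i + 1) (s := i) (by omega) (by omega)).cat
    (hf.shift (q := p - (i + 1)) (i + 1) (by omega)) ?_ ?_
  · rw [show i + 1 + (p - (i + 1)) = p by omega] at h1
    obtain ⟨j, hj, rfl⟩ := h1.exists_eq_of_adj_zero hmax (x := x) (by simpa [PathForest.cat] using hx)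
    simp only [PathForest.cat]
    split_ifs
    · exact ⟨_, by omega, rfl⟩
    · exact ⟨_, by omega, rfl⟩
  · intro s hs t ht hst
    have := hf.inj (by omega) (by omega) hst
    omega
  · intro _ _
    simpa using h0

/-- The cycle closed by a chord at each end of a path. -/
lemma PathSeq.exists_cycleSeq (hf : PathSeq G p f) {i j : ℕ} (hi : 1 ≤ i) (hij : i ≤ j)
    (hj : j < p) (hpi : G.Adj (f (p - 1)) (f (i - 1))) (h0j : G.Adj (f 0) (f j)) {m : ℕ}
    (hm : m + j = p + i) : ∃ c : ZMod m → V, CycleSeq G m c ∧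
      (∀ s, ∃ t < p, (t < i ∨ j ≤ t) ∧ c s = f t) ∧
      ∀ t < p, t < i ∨ j ≤ t → ∃ s, c s = f t := by
  obtain rfl : m = i + (p - j) := by omega
  have : NeZero (i + (p - j)) := ⟨by omega⟩
  -- The cycle runs from `f 0` to `f (i - 1)`, jumps to `f (p - 1)`, descends to `f j` and closes at
  -- `f 0`; it skips `f i, …, f (j - 1)`.
  have h1 := (hf.mono (by omega : i ≤ p)).cat
    (hf.shift_rev (q := p - j) (s := p - 1) (by omega) (by omega)) ?_ ?_
  · refine ⟨_, h1.cycleSeq ?_, ?_, ?_⟩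
    · have e1 : ¬ (i + (p - j) - 1 < i) := by omega
      have e2 : 0 < i := hi
      simp only [PathForest.cat, e1, e2, if_false, if_true]
      rw [show p - 1 - (i + (p - j) - 1 - i) = j by omega]
      exact h0j.symm
    · intro s
      have := ZMod.val_lt s
      simp only [PathForest.cat]
      split_ifs
      · exact ⟨_, by omega, Or.inl (by omega), rfl⟩
      · exact ⟨_, by omega, Or.inr (by omega), rfl⟩
    · intro t ht h
      rcases h with h | h
      · refine ⟨(t : ZMod _), ?_⟩
        simp only [ZMod.val_natCast_of_lt (by omega : t < i + (p - j)), PathForest.cat, h, if_true]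
      · refine ⟨((i + (p - 1 - t) : ℕ) : ZMod _), ?_⟩
        have e1 : ¬ (i + (p - 1 - t) < i) := by omega
        rw [ZMod.val_natCast_of_lt (by omega)]
        simp only [PathForest.cat, e1, if_false]
        congr 1
        omega
  · intro s hs t ht hst
    have := hf.inj (by omega) (by omega) hst
    omega
  · intro _ _
    simpa using hpi.symm

/-- The indices of the neighbours of the first vertex of `f`. -/
noncomputable def headNbrs (G : SimpleGraph V) (p : ℕ) (f : ℕ → V) : Finset ℕ :=
  open Classical in (Finset.Ico 1 p).filter fun i => G.Adj (f 0) (f i)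

/-- The indices of the successors of the neighbours of the last vertex of `f`. -/
noncomputable def lastNbrs (G : SimpleGraph V) (p : ℕ) (f : ℕ → V) : Finset ℕ :=
  open Classical in (Finset.Ico 1 p).filter fun i => G.Adj (f (p - 1)) (f (i - 1))

lemma mem_headNbrs {i : ℕ} : i ∈ headNbrs G p f ↔ (1 ≤ i ∧ i < p) ∧ G.Adj (f 0) (f i) := by
  simp [headNbrs]

lemma mem_lastNbrs {i : ℕ} :
    i ∈ lastNbrs G p f ↔ (1 ≤ i ∧ i < p) ∧ G.Adj (f (p - 1)) (f (i - 1)) := by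
  simp [lastNbrs]

lemma headNbrs_subset : headNbrs G p f ⊆ Finset.Ico 1 p := fun _ hi =>
  Finset.mem_Ico.2 (mem_headNbrs.1 hi).1

lemma lastNbrs_subset : lastNbrs G p f ⊆ Finset.Ico 1 p := fun _ hi =>
  Finset.mem_Ico.2 (mem_lastNbrs.1 hi).1

lemma PathSeq.minDegree_le_card_headNbrs [Fintype V] [DecidableRel G.Adj] (hf : PathSeq G p f)
    (hmax : ∀ q g, PathSeq G q g → q ≤ p) : G.minDegree ≤ (headNbrs G p f).card := by
  classical
  refine (G.minDegree_le_degree (f 0)).trans ?_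
  rw [← G.card_neighborFinset_eq_degree]
  refine (Finset.card_le_card fun z hz => ?_).trans
    (Finset.card_image_le (s := headNbrs G p f) (f := f))
  rw [mem_neighborFinset] at hz
  obtain ⟨i, hi, rfl⟩ := hf.exists_eq_of_adj_zero hmax hz
  refine Finset.mem_image_of_mem _ (mem_headNbrs.2 ⟨⟨?_, hi⟩, hz⟩)
  by_contra h
  obtain rfl : i = 0 := by omega
  exact hz.ne rfl

lemma card_headNbrs_rev (hp : 0 < p) :
    (headNbrs G p fun i => f (p - 1 - i)).card = (lastNbrs G p f).card := by
  refine Finset.card_nbij' (fun i => p - i) (fun i => p - i) ?_ ?_ ?_ ?_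
  · intro i hi
    rw [Finset.mem_coe, mem_headNbrs] at hi
    rw [Finset.mem_coe, mem_lastNbrs]
    dsimp only
    refine ⟨by omega, ?_⟩
    convert hi.2 using 2 <;> omega
  · intro i hi
    rw [Finset.mem_coe, mem_lastNbrs] at hi
    rw [Finset.mem_coe, mem_headNbrs]
    dsimp only
    refine ⟨by omega, ?_⟩
    convert hi.2 using 2 <;> omega
  · intro i hi
    rw [Finset.mem_coe, mem_headNbrs] at hi
    dsimp only
    omega
  · intro i hi
    rw [Finset.mem_coe, mem_lastNbrs] at hi
    dsimp only
    omega

lemma PathSeq.minDegree_le_card_lastNbrs [Fintype V] [DecidableRel G.Adj] (hf : PathSeq G p f)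
    (hp : 0 < p) (hmax : ∀ q g, PathSeq G q g → q ≤ p) : G.minDegree ≤ (lastNbrs G p f).card :=
  card_headNbrs_rev (G := G) (f := f) hp ▸ hf.rev.minDegree_le_card_headNbrs hmax

/-- A maximal path outside `P` that starts at `x`. -/
lemma exists_maximal_extension [Fintype V] (P : V → Prop) (x : V) (hx : ¬ P x) :
    ∃ r y, 0 < r ∧ PathSeq G r y ∧ y 0 = x ∧ (∀ i < r, ¬ P (y i)) ∧
      ∀ z, G.Adj (y (r - 1)) z → P z ∨ ∃ i < r, z = y i := by
  classical
  let R : ℕ → Prop := fun r => ∃ y, 0 < r ∧ PathSeq G r y ∧ y 0 = x ∧ ∀ i < r, ¬ P (y i)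
  have h1 : R 1 := ⟨fun _ => x, one_pos, pathSeq_one x, rfl, fun _ _ => hx⟩
  obtain ⟨y, hr, hy, hy0, hyP⟩ := Nat.findGreatest_spec (P := R) (n := Fintype.card V)
    (Fintype.card_pos_iff.2 ⟨x⟩) h1
  refine ⟨_, y, hr, hy, hy0, hyP, fun z hz => ?_⟩
  by_contra! hcon
  have h2 := hy.cat (pathSeq_one z) (fun i hi _ _ => (hcon.2 i hi).symm) fun _ _ => hz
  have h3 : R (Nat.findGreatest R (Fintype.card V) + 1) := by
    refine ⟨_, Nat.succ_pos _, h2, by simpa only [PathForest.cat, hr, if_true] using hy0,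
      fun i _ => ?_⟩
    simp only [PathForest.cat]
    split_ifs with h4
    · exact hyP i h4
    · exact hcon.1
  have := Nat.le_findGreatest h2.le_card h3
  omega

/-- The last vertex is not its own neighbour, hence `r - 1`. When `t` is a single vertex and the
minimum degree is at least `h`, this gives `r ≥ h`. -/
lemma minDegree_le_of_extension [Fintype V] [DecidableRel G.Adj] {r : ℕ} {y : ℕ → V}
    (hr : 0 < r) (t : Finset V) (h : ∀ z, G.Adj (y (r - 1)) z → z ∈ t ∨ ∃ i < r, z = y i) :
    G.minDegree ≤ t.card + (r - 1) := by
  classical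
  refine (G.minDegree_le_degree (y (r - 1))).trans ?_
  rw [← G.card_neighborFinset_eq_degree]
  calc _ ≤ (t ∪ (Finset.range (r - 1)).image y).card := by
        refine Finset.card_le_card fun z hz => ?_
        rw [mem_neighborFinset] at hz
        rw [Finset.mem_union, Finset.mem_image]
        rcases h z hz with h1 | ⟨i, hi, rfl⟩
        · exact Or.inl h1
        · refine Or.inr ⟨i, Finset.mem_range.2 ?_, rfl⟩
          by_contra h2
          obtain rfl : i = r - 1 := by omega
          exact hz.ne rfl
    _ ≤ _ := by
        refine (Finset.card_union_le _ _).trans (Nat.add_le_add_left ?_ _)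
        simpa using Finset.card_image_le (s := Finset.range (r - 1)) (f := y)

end LongestPath

/-! ### Relative position of the two index sets. -/

section Patterns

variable {p h : ℕ} {A B : Finset ℕ}

/-- At most `e` indices lie outside `A ∪ B`. Take `i ∈ B` and `i + d ∈ A` with `d` minimal: all `d -
1` indices strictly between are unused, so `d ≤ e + 1`, which is excluded. -/
lemma lt_of_no_short_gap (e : ℕ) (hA : A ⊆ Finset.Ico 1 p) (hB : B ⊆ Finset.Ico 1 p)
    (hAc : h ≤ A.card) (hBc : h ≤ B.card) (hdis : Disjoint A B) (hp : p ≤ 2 * h + 1 + e)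
    (hgap : ∀ i ∈ B, ∀ d, d ≤ e + 1 → i + d ∉ A) : ∀ j ∈ A, ∀ i ∈ B, j < i := by
  have hU : (Finset.Ico 1 p \ (A ∪ B)).card ≤ e := by
    rw [Finset.card_sdiff_of_subset (Finset.union_subset hA hB),
      Finset.card_union_of_disjoint hdis, Nat.card_Ico]
    omega
  have key : ∀ d, ∀ i ∈ B, i + d ∉ A := by
    intro d
    induction d using Nat.strong_induction_on with
    | _ d ih =>
      intro i hi hj
      by_cases hd : d ≤ e + 1
      · exact hgap i hi d hd hj
      · have hsub : Finset.Ioo i (i + d) ⊆ Finset.Ico 1 p \ (A ∪ B) := by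
          intro x hx
          rw [Finset.mem_Ioo] at hx
          have h1 := Finset.mem_Ico.1 (hA hj)
          rw [Finset.mem_sdiff, Finset.mem_Ico, Finset.mem_union, not_or]
          refine ⟨by omega, ?_, ?_⟩
          · intro hxA
            refine ih (x - i) (by omega) i hi ?_
            rwa [show i + (x - i) = x by omega]
          · intro hxB
            refine ih (i + d - x) (by omega) x hxB ?_
            rwa [show x + (i + d - x) = i + d by omega]
        have := (Finset.card_le_card hsub).trans hU
        rw [Nat.card_Ioo] at this
        omega
  intro j hj i hi
  by_contra! hij
  refine key (j - i) i hi ?_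
  rwa [show i + (j - i) = j by omega]

lemma exists_threshold (hh : 1 ≤ h) (hA : A ⊆ Finset.Ico 1 p) (hB : B ⊆ Finset.Ico 1 p)
    (hAc : h ≤ A.card) (hBc : h ≤ B.card) (hlt : ∀ j ∈ A, ∀ i ∈ B, j < i) :
    ∃ m, h ≤ m ∧ h + m + 1 ≤ p ∧ A ⊆ Finset.Icc 1 m ∧ B ⊆ Finset.Ico (m + 1) p := by
  have hne : A.Nonempty := Finset.card_pos.1 (by omega)
  have h1 : A ⊆ Finset.Icc 1 (A.max' hne) := fun x hx => by
    have := Finset.mem_Ico.1 (hA hx)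
    exact Finset.mem_Icc.2 ⟨this.1, A.le_max' x hx⟩
  have h2 : B ⊆ Finset.Ico (A.max' hne + 1) p := fun x hx => by
    have := Finset.mem_Ico.1 (hB hx)
    exact Finset.mem_Ico.2 ⟨hlt _ (A.max'_mem hne) x hx, this.2⟩
  have h3 := Finset.card_le_card h1
  have h4 := Finset.card_le_card h2
  rw [Nat.card_Icc] at h3
  rw [Nat.card_Ico] at h4
  exact ⟨_, by omega, by omega, h1, h2⟩

end Patterns

/-! ### Longest paths without short chord cycles. -/

section CutVertices

variable {V : Type*} {G : SimpleGraph V} {h : ℕ}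

/-- A component of order at most `h` goes on the first pair of paths, the others having at most `2h
+ 1` vertices. If there is none, the forest has two components, of orders `h + 1` and `h + 2`, and
the second pair fits. -/
lemma forest_isContained_of_four_paths {k : ℕ} {a : Fin k → ℕ} {b : ℕ} (hk : 1 ≤ k) (ha : ∀ i, 1 ≤ a i) (hb : 1 ≤ b)
    (hh : h + 1 = (∑ i, a i) + b) (hh1 : 1 ≤ h) {f f' g g' : ℕ → V} (hf : PathSeq G h f)
    (hf' : PathSeq G (2 * h + 1) f') (hff' : ∀ i < h, ∀ j < 2 * h + 1, f i ≠ f' j)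
    (hg : PathSeq G (h + 1) g) (hg' : PathSeq G (h + 2) g')
    (hgg' : ∀ i < h + 1, ∀ j < h + 2, g i ≠ g' j) : forest a b ⊑ G := by
  rcases exists_order_le_or (b := b) ha hk hh1 hh with ⟨i, hi⟩ | ⟨rfl, hab⟩
  · refine forest_isContained_of_order_le (m := 2) hh hf hf' hff' i hi ?_ (by omega)
    cases i with
    | none => simp only [orders]; omega
    | some i => have := ha i; simp only [orders]; omega
  · rw [Fin.sum_univ_one] at hh
    rcases hab 0 with h0 | h0
    · refine forest_isContained_of_two_paths hg hg' hgg' {some 0} ?_ ?_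
      · simp [orders]
        omega
      · have := sum_orders a b
        rw [← Finset.sum_add_sum_compl {some 0}, Finset.sum_singleton, Fin.sum_univ_one] at this
        simp only [orders] at this ⊢
        omega
    · refine forest_isContained_of_two_paths hg hg' hgg' {none} ?_ ?_
      · simp [orders]
        omega
      · have := sum_orders a b
        rw [← Finset.sum_add_sum_compl {none}, Finset.sum_singleton, Fin.sum_univ_one] at this
        simp only [orders] at this ⊢
        omega

variable [Fintype V] [DecidableRel G.Adj]

/-- In a longest path with `2h + 1` vertices, the first `h + 1` vertices form a clique, of which
only the last vertex has neighbours outside. -/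
lemma adj_iff_of_longest_odd (hh : 1 ≤ h) (hG : G.Connected) (hδ : h ≤ G.minDegree)
    (hmax : ∀ q g, PathSeq G q g → q ≤ 2 * h + 1) (hV : 2 * h + 1 < Fintype.card V)
    (hno : ∀ c : ZMod (2 * h) → V, ¬ CycleSeq G (2 * h) c) {f : ℕ → V}
    (hf : PathSeq G (2 * h + 1) f) (i : ℕ) (hi : i < h) (x : V) :
    G.Adj (f i) x ↔ ∃ t ≤ h, t ≠ i ∧ x = f t := by
  classical
  have nocyc : ∀ c : ZMod (2 * h + 1) → V, ¬ CycleSeq G (2 * h + 1) c := by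
    intro c hc
    obtain ⟨g, hg⟩ := hc.exists_longer hG hV
    have := hmax _ _ hg
    omega
  have chord : ∀ i ∈ lastNbrs G (2 * h + 1) f, ∀ d, d ≤ 1 → i + d ∉ headNbrs G (2 * h + 1) f := by
    intro i hi d hd hid
    rw [mem_lastNbrs] at hi
    rw [mem_headNbrs] at hid
    obtain rfl | rfl : d = 0 ∨ d = 1 := by omega
    · obtain ⟨c, hc, -⟩ := hf.exists_cycleSeq hi.1.1 (by omega) hid.1.2 hi.2 hid.2
        (m := 2 * h + 1) (by omega)
      exact nocyc c hc
    · obtain ⟨c, hc, -⟩ := hf.exists_cycleSeq hi.1.1 (by omega) hid.1.2 hi.2 hid.2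
        (m := 2 * h) (by omega)
      exact hno c hc
  have hA := hδ.trans (hf.minDegree_le_card_headNbrs hmax)
  have hB := hδ.trans (hf.minDegree_le_card_lastNbrs (by omega) hmax)
  have hlt := lt_of_no_short_gap 0 headNbrs_subset lastNbrs_subset hA hB
    (Finset.disjoint_right.2 fun i hi => by simpa using chord i hi 0 (by omega)) (by omega) chord
  obtain ⟨m, hm1, hm2, hm3, hm4⟩ := exists_threshold hh headNbrs_subset lastNbrs_subset hA hB hlt
  obtain rfl : m = h := by omega
  have eA := Finset.eq_of_subset_of_card_le hm3 (by simpa using hA)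
  have eB := Finset.eq_of_subset_of_card_le hm4 (by rw [Nat.card_Ico]; omega)
  have head : ∀ i, 1 ≤ i → i ≤ m → G.Adj (f 0) (f i) := fun i h1 h2 =>
    (mem_headNbrs.1 (eA ▸ Finset.mem_Icc.2 ⟨h1, h2⟩)).2
  have last : ∀ i, m ≤ i → i < 2 * m → G.Adj (f (2 * m)) (f i) := fun i h1 h2 =>
    (mem_lastNbrs.1 (eB ▸ Finset.mem_Ico.2 ⟨by omega, by omega⟩ :
      i + 1 ∈ lastNbrs G (2 * m + 1) f)).2
  have near : ∀ x, G.Adj (f i) x → ∃ t ≤ m, t ≠ i ∧ x = f t := by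
    intro x hx
    obtain ⟨t, ht, rfl⟩ := hf.exists_eq_of_adj_rotate hmax (by omega) (head (i + 1) (by omega)
      (by omega)) hx
    refine ⟨t, ?_, fun hti => hx.ne (by rw [hti]), rfl⟩
    by_contra! htm
    -- A neighbour `f t` beyond the middle closes a cycle through the whole path: `f t, …, f (2m)`,
    -- then `f (t - 1)` down to `f (i + 1)`, then `f 0, …, f i`.
    have h1 := (((hf.shift (q := 2 * m + 1 - t) t (by omega)).cat
      (hf.shift_rev (q := t - 1 - i) (s := t - 1) (by omega) (by omega)) ?_ ?_).cat
      (hf.mono (by omega : i + 1 ≤ 2 * m + 1)) ?_ ?_)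
    · rw [show 2 * m + 1 - t + (t - 1 - i) + (i + 1) = 2 * m + 1 by omega] at h1
      refine nocyc _ (h1.cycleSeq ?_)
      have e1 : ¬ (2 * m + 1 - 1 < 2 * m + 1 - t + (t - 1 - i)) := by omega
      have e2 : 0 < 2 * m + 1 - t + (t - 1 - i) := by omega
      have e3 : 0 < 2 * m + 1 - t := by omega
      simp only [cat, e1, e2, e3, if_true, if_false]
      rwa [show 2 * m + 1 - 1 - (2 * m + 1 - t + (t - 1 - i)) = i by omega]
    · intro s hs u hu hsu
      have := hf.inj (by omega) (by omega) hsu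
      omega
    · intro _ _
      rw [show t + (2 * m + 1 - t - 1) = 2 * m by omega]
      exact last _ (by omega) (by omega)
    · intro s hs u hu
      simp only [cat]
      split_ifs
      · intro hsu
        have := hf.inj (by omega) (by omega) hsu
        omega
      · intro hsu
        have := hf.inj (by omega) (by omega) hsu
        omega
    · intro _ _
      have e1 : ¬ (2 * m + 1 - t + (t - 1 - i) - 1 < 2 * m + 1 - t) := by omega
      simp only [cat, e1, if_false]
      rw [show t - 1 - (2 * m + 1 - t + (t - 1 - i) - 1 - (2 * m + 1 - t)) = i + 1 by omega]
      exact (head _ (by omega) (by omega)).symm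
  have hsub : G.neighborFinset (f i) ⊆ ((Finset.range (m + 1)).erase i).image f := by
    intro x hx
    rw [mem_neighborFinset] at hx
    obtain ⟨t, h1, h2, rfl⟩ := near x hx
    exact Finset.mem_image_of_mem _ (Finset.mem_erase.2 ⟨h2, Finset.mem_range.2 (by omega)⟩)
  -- Only `h` candidates are available for at least `h` neighbours, so all of them occur.
  have heq := Finset.eq_of_subset_of_card_le hsub (by
    refine Finset.card_image_le.trans ?_
    rw [Finset.card_erase_of_mem (Finset.mem_range.2 (by omega)), Finset.card_range,
      G.card_neighborFinset_eq_degree]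
    exact hδ.trans (G.minDegree_le_degree _))
  refine ⟨near x, ?_⟩
  rintro ⟨t, h1, h2, rfl⟩
  rw [← mem_neighborFinset, heq]
  exact Finset.mem_image_of_mem _ (Finset.mem_erase.2 ⟨h2, Finset.mem_range.2 (by omega)⟩)

/-- Every vertex other than the middle `f h` lies in the first half of some longest path with the
same middle, so `adj_iff_of_longest_odd` describes its whole neighbourhood. -/
lemma iso_L_of_longest_odd (hh : 1 ≤ h) (hG : G.Connected) (hδ : h ≤ G.minDegree)
    (hmax : ∀ q g, PathSeq G q g → q ≤ 2 * h + 1) (hV : 2 * h + 1 < Fintype.card V)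
    (hno : ∀ c : ZMod (2 * h) → V, ¬ CycleSeq G (2 * h) c) {f : ℕ → V}
    (hf : PathSeq G (2 * h + 1) f) :
    (∃ t, Fintype.card V = t * h + 1 ∧ Nonempty (G ≃g L t h)) ∧
      ∃ g, PathSeq G h g ∧ ∀ i < h, ∀ j < 2 * h + 1, g i ≠ f j := by
  classical
  have key := fun {g} => adj_iff_of_longest_odd (f := g) hh hG hδ hmax hV hno
  have frev : PathSeq G (2 * h + 1) fun i => f (2 * h - i) := hf.rev
  have good : ∀ v, v = f h ∨ ∃ g, PathSeq G (2 * h + 1) g ∧ g h = f h ∧ ∃ i < h, v = g i := by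
    intro v
    refine eq_univ_of_connected hG {v | v = f h ∨ ∃ g, PathSeq G (2 * h + 1) g ∧ g h = f h ∧
      ∃ i < h, v = g i} (f h) (Or.inl rfl) ?_ v
    rintro x (rfl | ⟨g, hg, hgh, i, hi, rfl⟩) y hxy
    · by_cases hy : ∃ j < 2 * h + 1, y = f j
      · obtain ⟨j, hj, rfl⟩ := hy
        rcases lt_trichotomy j h with hjh | rfl | hjh
        · exact Or.inr ⟨f, hf, rfl, j, hjh, rfl⟩
        · exact Or.inl rfl
        · refine Or.inr ⟨_, frev, ?_, 2 * h - j, by omega, ?_⟩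
          · rw [show 2 * h - h = h by omega]
          · rw [show 2 * h - (2 * h - j) = j by omega]
      · obtain ⟨r, w, hr, hw, hw0, hwP, hw'⟩ :=
          exists_maximal_extension (G := G) (fun v => ∃ j < 2 * h + 1, v = f j) y hy
        have hdeg := minDegree_le_of_extension (G := G) hr {f h} fun z hz => by
          rcases hw' z hz with ⟨j, hj, rfl⟩ | h1
          · left
            rw [Finset.mem_singleton]
            rcases lt_trichotomy j h with hjh | rfl | hjh
            · obtain ⟨t, ht, -, h2⟩ := (key hf j hjh _).1 hz.symm
              exact absurd ⟨t, by omega, h2⟩ (hwP (r - 1) (by omega))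
            · rfl
            · have e : f (2 * h - (2 * h - j)) = f j := by
                rw [show 2 * h - (2 * h - j) = j by omega]
              obtain ⟨t, ht, -, h2⟩ := (key frev (2 * h - j) (by omega) (w (r - 1))).1
                (by rw [e]; exact hz.symm)
              exact absurd ⟨_, by omega, h2⟩ (hwP (r - 1) (by omega))
          · exact Or.inr h1
        rw [Finset.card_singleton] at hdeg
        -- The extension meets the path only through `f h`, so it has at least `h` vertices; `h` of
        -- them, followed by `f h, …, f 0`, form a new longest path with middle `f h`.
        have h1 := (hw.shift_rev (q := h) (s := h - 1) (by omega) (by omega)).cat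
          (hf.shift_rev (q := h + 1) (s := h) (by omega) (by omega)) ?_ ?_
        · rw [show h + (h + 1) = 2 * h + 1 by omega] at h1
          refine Or.inr ⟨_, h1, by simp [cat], h - 1, by omega, ?_⟩
          simp [cat, hw0, show 0 < h by omega]
        · intro s hs t ht hst
          exact hwP _ (by omega) ⟨_, by omega, hst⟩
        · intro _ _
          simp only [Nat.sub_self, Nat.sub_zero, hw0]
          exact hxy.symm
    · obtain ⟨t, ht, -, rfl⟩ := (key hg i hi y).1 hxy
      rcases ht.lt_or_eq with ht | rfl
      · exact Or.inr ⟨g, hg, hgh, t, ht, rfl⟩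
      · exact Or.inl hgh
  constructor
  · refine nonempty_iso_L (f h) h ?_ ?_ ?_
    · intro x hx
      obtain ⟨g, hg, hgh, i, hi, rfl⟩ := (good x).resolve_left hx
      exact ((key hg i hi _).2 ⟨h, le_rfl, by omega, hgh.symm⟩).symm
    · intro x y z hx hy hz hxy hyz hxz
      obtain ⟨g, hg, hgh, i, hi, rfl⟩ := (good x).resolve_left hx
      obtain ⟨t, ht, -, rfl⟩ := (key hg i hi y).1 hxy
      have ht' : t ≠ h := by
        rintro rfl
        exact hy hgh
      obtain ⟨s, hs, -, rfl⟩ := (key hg t (by omega) z).1 hyz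
      exact (key hg i hi _).2 ⟨s, hs, fun hsi => hxz (by rw [hsi]), rfl⟩
    · intro x hx
      obtain ⟨g, hg, hgh, i, hi, rfl⟩ := (good x).resolve_left hx
      refine ⟨(Finset.range h).image g, ?_, fun y => ?_⟩
      · rw [Finset.card_image_of_injOn, Finset.card_range]
        intro s hs t ht hst
        rw [Finset.mem_coe, Finset.mem_range] at hs ht
        exact hg.inj (by omega) (by omega) hst
      · rw [key hg i hi, Finset.mem_image]
        constructor
        · rintro ⟨t, ht, rfl⟩
          rw [Finset.mem_range] at ht
          refine ⟨fun hth => ?_, ?_⟩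
          · have := hg.inj (by omega) (by omega) (hth.trans hgh.symm)
            omega
          · by_cases hti : t = i
            · exact Or.inl (by rw [hti])
            · exact Or.inr ⟨t, ht.le, hti, rfl⟩
        · rintro ⟨h1, rfl | ⟨t, ht, h2, rfl⟩⟩
          · exact ⟨i, Finset.mem_range.2 hi, rfl⟩
          · have : t ≠ h := by
              rintro rfl
              exact h1 hgh
            exact ⟨t, Finset.mem_range.2 (by omega), rfl⟩
  · obtain ⟨y, hy⟩ : ∃ y, y ∉ (Finset.range (2 * h + 1)).image f := by
      by_contra! hcon
      have h1 := Finset.card_le_card (fun x _ => hcon x :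
        Finset.univ ⊆ (Finset.range (2 * h + 1)).image f)
      have h2 := Finset.card_image_le (s := Finset.range (2 * h + 1)) (f := f)
      rw [Finset.card_univ] at h1
      rw [Finset.card_range] at h2
      omega
    simp only [Finset.mem_image, Finset.mem_range, not_exists, not_and] at hy
    obtain ⟨g, hg, hgh, i, hi, rfl⟩ := (good y).resolve_left fun h1 => hy h (by omega) h1.symm
    refine ⟨g, hg.mono (by omega), fun t ht j hj htj => ?_⟩
    have hti : t ≠ i := by
      rintro rfl
      exact hy j hj htj.symm
    have hadj : G.Adj (f j) (g i) := htj ▸ (key hg t ht (g i)).2 ⟨i, hi.le, hti.symm, rfl⟩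
    rcases lt_trichotomy j h with hjh | rfl | hjh
    · obtain ⟨s, hs, -, h1⟩ := (key hf j hjh _).1 hadj
      exact hy s (by omega) h1.symm
    · have := hg.inj (by omega) (by omega) (htj.trans hgh.symm)
      omega
    · have e : f (2 * h - (2 * h - j)) = f j := by
        rw [show 2 * h - (2 * h - j) = j by omega]
      obtain ⟨s, hs, -, h1⟩ := (key frev (2 * h - j) (by omega) (g i)).1 (by rw [e]; exact hadj)
      exact hy _ (by omega) h1.symm

variable {k : ℕ} {a : Fin k → ℕ} {b : ℕ}

/-- Rotations show that only `f h` and one further vertex, the successor of the single possible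
non-neighbour of the last vertex, can have neighbours off the path. A part hanging at just one of
them has at least `h` vertices. -/
lemma forest_isContained_of_longest_even (hk : 1 ≤ k) (ha : ∀ i, 1 ≤ a i) (hb : 1 ≤ b)
    (hh : h + 1 = (∑ i, a i) + b) (hh1 : 1 ≤ h) (hG : G.Connected) (hδ : h ≤ G.minDegree)
    (hmax : ∀ q g, PathSeq G q g → q ≤ 2 * h + 2) (hV : 2 * h + 2 < Fintype.card V)
    {f : ℕ → V} (hf : PathSeq G (2 * h + 2) f)
    (head : ∀ i, 1 ≤ i → i ≤ h → G.Adj (f 0) (f i))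
    (last : ∀ i j, h ≤ i → i ≤ 2 * h → h ≤ j → j ≤ 2 * h → ¬ G.Adj (f (2 * h + 1)) (f i) →
      ¬ G.Adj (f (2 * h + 1)) (f j) → i = j) : forest a b ⊑ G := by
  classical
  have frev : PathSeq G (2 * h + 2) fun i => f (2 * h + 1 - i) := hf.rev
  have attach : ∀ t < 2 * h + 2, ∀ y, (¬ ∃ j < 2 * h + 2, y = f j) → G.Adj (f t) y →
      t = h ∨ h + 1 ≤ t ∧ t ≤ 2 * h ∧ ¬ G.Adj (f (2 * h + 1)) (f (t - 1)) := by
    intro t ht y hy hty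
    by_contra! hcon
    apply hy
    by_cases hth : t < h
    · exact hf.exists_eq_of_adj_rotate hmax (by omega) (head (t + 1) (by omega) (by omega)) hty
    · by_cases ht' : t = 2 * h + 1
      · subst ht'
        obtain ⟨j, hj, rfl⟩ := frev.exists_eq_of_adj_zero hmax (x := y) (by simpa using hty)
        exact ⟨_, by omega, rfl⟩
      · have h1 := hcon.2 (by omega) (by omega)
        obtain ⟨j, hj, rfl⟩ := frev.exists_eq_of_adj_rotate (i := 2 * h + 1 - t) hmax (x := y)
          (by omega)
          (by
            rwa [show 2 * h + 1 - (2 * h + 1 - t + 1) = t - 1 by omega])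
          (by
            rwa [show 2 * h + 1 - (2 * h + 1 - t) = t by omega])
        exact ⟨_, by omega, rfl⟩
  by_cases hc : ∃ y, (¬ ∃ j < 2 * h + 2, y = f j) ∧ G.Adj (f h) y
  · obtain ⟨x, hx, hhx⟩ := hc
    obtain ⟨r, y, hr, hy, rfl, hyP, hy'⟩ :=
      exists_maximal_extension (G := G) (fun v => ∃ j < 2 * h + 2, v = f j) x hx
    have hd : ∀ i < r, ∀ j < 2 * h + 2, y i ≠ f j := fun i hi j hj hij => hyP i hi ⟨j, hj, hij⟩
    by_cases hz : ∃ t < 2 * h + 2, t ≠ h ∧ G.Adj (f t) (y (r - 1))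
    · obtain ⟨t, ht, hth, hzt⟩ := hz
      obtain ⟨h1, h2, h3⟩ := (attach t ht _ (hyP _ (by omega)) hzt).resolve_left hth
      -- The detour `f 0, …, f h`, `y`, `f t, …, f (2h + 1)`, continued if `t > h + 1` by `f (t -
      -- 2), …, f (h + 1)`, omits at most the vertex `f (t - 1)` of the path. Hence `r = 1`, and the
      -- degree bound leaves `h = 2`, `t = 4`.
      have hp1 := (hf.mono (by omega : h + 1 ≤ 2 * h + 2)).cat hy
        (fun i hi j hj => (hd j hj i (by omega)).symm) (fun _ _ => by simpa using hhx)
      have hp2 := hp1.cat (hf.shift (q := 2 * h + 2 - t) t (by omega)) ?_ ?_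
      · by_cases hth1 : t = h + 1
        · have := hmax _ _ hp2
          omega
        · have ht2 : G.Adj (f (2 * h + 1)) (f (t - 2)) := by
            by_contra hcon
            have := last (t - 1) (t - 2) (by omega) (by omega) (by omega) (by omega) h3 hcon
            omega
          have hp3 := hp2.cat (hf.shift_rev (q := t - 2 - h) (s := t - 2) (by omega) (by omega))
            ?_ ?_
          · have := hmax _ _ hp3
            obtain rfl : r = 1 := by omega
            have hdeg := minDegree_le_of_extension (G := G) hr {f h, f t} fun z hz => by
              rcases hy' z hz with ⟨j, hj, rfl⟩ | h4
              · left
                rw [Finset.mem_insert, Finset.mem_singleton]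
                rcases attach j hj _ (hyP _ (by omega)) hz.symm with rfl | ⟨h5, h6, h7⟩
                · exact Or.inl rfl
                · have := last (j - 1) (t - 1) (by omega) (by omega) (by omega) (by omega) h7 h3
                  obtain rfl : j = t := by omega
                  exact Or.inr rfl
              · exact Or.inr h4
            have := Finset.card_le_two (a := f h) (b := f t)
            obtain rfl : h = 2 := by omega
            obtain rfl : t = 4 := by omega
            have a52 : G.Adj (f 5) (f 2) := ht2
            have a01 := hf.adj (i := 0) (by omega)
            have a12 := hf.adj (i := 1) (by omega)
            have a23 := hf.adj (i := 2) (by omega)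
            have a45 := hf.adj (i := 4) (by omega)
            norm_num at a01 a12 a23 a45 hzt
            have ne : ∀ i < 6, y 0 ≠ f i := fun i hi => hd 0 (by omega) i hi
            have ne' : ∀ i < 6, f i ≠ y 0 := fun i hi => (ne i hi).symm
            have nf : ∀ i < 6, ∀ j < 6, f i = f j ↔ i = j := fun i hi j hj =>
              ⟨fun hij => hf.inj hi hj hij, fun hij => by rw [hij]⟩
            have hs := sum_orders a b
            rw [← Finset.sum_add_sum_compl {none}, Finset.sum_singleton] at hs
            have hsa : 1 ≤ ∑ i, a i := (ha ⟨0, hk⟩).trans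
              (Finset.single_le_sum (fun _ _ => Nat.zero_le _) (Finset.mem_univ _))
            simp only [orders] at hs
            by_cases hb2 : b = 2
            · subst hb2
              refine forest_isContained_of_two_lists [f 3, f 2, f 5, f 4, y 0] [f 0, f 1] ?_ ?_ ?_
                {none} (by simp [orders]) ?_
              · simp [ne, ne', nf]
              · simp [a23.symm, a52.symm, a45.symm, hzt]
              · simpa using a01
              · simp only [List.length_cons, List.length_nil, orders]
                omega
            · refine forest_isContained_of_two_lists [f 5, f 4, y 0] [f 0, f 1, f 2, f 3] ?_ ?_ ?_
                {none} (by simp [orders]; omega) ?_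
              · simp [ne, ne', nf]
              · simp [a45.symm, hzt]
              · simp [a01, a12, a23]
              · simp only [List.length_cons, List.length_nil, orders]
                omega
          · intro s hs u hu
            simp only [cat]
            split_ifs
            · intro hsu
              have := hf.inj (by omega) (by omega) hsu
              omega
            · exact hd _ (by omega) _ (by omega)
            · intro hsu
              have := hf.inj (by omega) (by omega) hsu
              omega
          · intro _ _
            have e1 : ¬ (h + 1 + r + (2 * h + 2 - t) - 1 < h + 1 + r) := by omega
            simp only [cat, e1, if_false]
            rw [show t + (h + 1 + r + (2 * h + 2 - t) - 1 - (h + 1 + r)) = 2 * h + 1 by omega]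
            exact ht2
      · intro s hs u hu
        simp only [cat]
        split_ifs
        · intro hsu
          have := hf.inj (by omega) (by omega) hsu
          omega
        · exact hd _ (by omega) _ (by omega)
      · intro _ _
        have e1 : ¬ (h + 1 + r - 1 < h + 1) := by omega
        simp only [cat, e1, if_false]
        rw [show h + 1 + r - 1 - (h + 1) = r - 1 by omega]
        exact hzt.symm
    · push Not at hz
      have hdeg := minDegree_le_of_extension (G := G) hr {f h} fun z hz' => by
        rcases hy' z hz' with ⟨j, hj, rfl⟩ | h4
        · left
          rw [Finset.mem_singleton]
          by_contra hjh
          exact hz j hj (fun e => hjh (by rw [e])) hz'.symm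
        · exact Or.inr h4
      rw [Finset.card_singleton] at hdeg
      -- Attachment at `f h` only: `y` against the path, and the second half against the first half
      -- lengthened by `y 0`.
      refine forest_isContained_of_four_paths hk ha hb hh hh1 (hy.mono (by omega : h ≤ r))
        (hf.mono (by omega)) (fun i hi j hj => hd i (by omega) j (by omega))
        (hf.shift (q := h + 1) (h + 1) (by omega))
        ((hf.mono (by omega : h + 1 ≤ 2 * h + 2)).cat (pathSeq_one (y 0))
          (fun i hi j hj => (hd 0 hr i (by omega)).symm) (fun _ _ => by simpa using hhx)) ?_
      intro i hi j hj
      simp only [cat]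
      split_ifs
      · intro hsu
        have := hf.inj (by omega) (by omega) hsu
        omega
      · exact (hd _ (by omega) _ (by omega)).symm
  · obtain ⟨x, hx, t, ht, htx⟩ : ∃ x, (¬ ∃ j < 2 * h + 2, x = f j) ∧ ∃ t < 2 * h + 2,
        G.Adj (f t) x := by
      by_contra! hcon
      have hall := eq_univ_of_connected hG {v | ∃ j < 2 * h + 2, v = f j} (f 0)
        ⟨0, by omega, rfl⟩ (by
          rintro _ ⟨j, hj, rfl⟩ y hy
          by_contra hy'
          exact hcon y (fun i hi hyi => hy' ⟨i, hi, hyi⟩) j hj hy)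
      have h1 := Finset.card_le_card (fun x _ => by
        obtain ⟨j, hj, rfl⟩ := hall x
        exact Finset.mem_image_of_mem _ (Finset.mem_range.2 hj) :
        Finset.univ ⊆ (Finset.range (2 * h + 2)).image f)
      have h2 := Finset.card_image_le (s := Finset.range (2 * h + 2)) (f := f)
      rw [Finset.card_univ] at h1
      rw [Finset.card_range] at h2
      omega
    obtain ⟨r, y, hr, hy, rfl, hyP, hy'⟩ :=
      exists_maximal_extension (G := G) (fun v => ∃ j < 2 * h + 2, v = f j) x hx
    have hd : ∀ i < r, ∀ j < 2 * h + 2, y i ≠ f j := fun i hi j hj hij => hyP i hi ⟨j, hj, hij⟩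
    push Not at hc
    have hth : t ≠ h := by
      rintro rfl
      exact hc _ (hd 0 hr) htx
    obtain ⟨h1, h2, h3⟩ := (attach t ht _ hx htx).resolve_left hth
    have hdeg := minDegree_le_of_extension (G := G) hr {f t} fun z hz => by
      rcases hy' z hz with ⟨j, hj, rfl⟩ | h4
      · left
        rw [Finset.mem_singleton]
        rcases attach j hj _ (hyP _ (by omega)) hz.symm with rfl | ⟨h5, h6, h7⟩
        · exact absurd hz.symm (hc _ (hd _ (by omega)))
        · have := last (j - 1) (t - 1) (by omega) (by omega) (by omega) (by omega) h7 h3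
          rw [show j = t by omega]
      · exact Or.inr h4
    rw [Finset.card_singleton] at hdeg
    by_cases hth1 : t = h + 1
    · subst hth1
      refine forest_isContained_of_four_paths hk ha hb hh hh1 (hy.mono (by omega : h ≤ r))
        (hf.mono (by omega)) (fun i hi j hj => hd i (by omega) j (by omega))
        (hf.mono (by omega))
        ((hf.shift_rev (q := h + 1) (s := 2 * h + 1) (by omega) (by omega)).cat
          (pathSeq_one (y 0)) (fun i hi j hj => (hd 0 hr _ (by omega)).symm) (fun _ _ => ?_)) ?_
      · rw [show 2 * h + 1 - (h + 1 - 1) = h + 1 by omega]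
        exact htx
      · intro i hi j hj
        simp only [cat]
        split_ifs
        · intro hsu
          have := hf.inj (by omega) (by omega) hsu
          omega
        · exact (hd _ (by omega) _ (by omega)).symm
    · have ht2 : G.Adj (f (2 * h + 1)) (f (t - 2)) := by
        by_contra hcon
        have := last (t - 1) (t - 2) (by omega) (by omega) (by omega) (by omega) h3 hcon
        omega
      -- The path `f 0, …, f (t - 2)`, `f (2h + 1), …, f t`, `y` has `2h + 1 + r` vertices, too many
      -- because `r ≥ h ≥ 2` here.
      have hp := ((hf.mono (by omega : t - 1 ≤ 2 * h + 2)).cat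
        (hf.shift_rev (q := 2 * h + 2 - t) (s := 2 * h + 1) (by omega) (by omega)) ?_ ?_).cat hy
        ?_ ?_
      · have := hmax _ _ hp
        omega
      · intro i hi j hj hij
        have := hf.inj (by omega) (by omega) hij
        omega
      · intro _ _
        rw [show t - 1 - 1 = t - 2 by omega]
        exact ht2.symm
      · intro i hi j hj
        simp only [cat]
        split_ifs
        · exact (hd _ (by omega) _ (by omega)).symm
        · exact (hd _ (by omega) _ (by omega)).symm
      · intro _ _
        have e1 : ¬ (t - 1 + (2 * h + 2 - t) - 1 < t - 1) := by omega
        simp only [cat, e1, if_false]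
        rw [show 2 * h + 1 - (t - 1 + (2 * h + 2 - t) - 1 - (t - 1)) = t by omega]
        exact htx

end CutVertices

/-! ### Assembling the cases. -/

section Main

lemma eq_of_mem_sdiff_of_card_le {α : Type*} [DecidableEq α] {s t : Finset α} (hst : s ⊆ t)
    (h : t.card ≤ s.card + 1) {x y : α} (hx : x ∈ t) (hx' : x ∉ s) (hy : y ∈ t) (hy' : y ∉ s) :
    x = y := by
  have h1 : (t \ s).card ≤ 1 := by
    rw [Finset.card_sdiff_of_subset hst]
    omega
  exact Finset.card_le_one.1 h1 x (Finset.mem_sdiff.2 ⟨hx, hx'⟩) y (Finset.mem_sdiff.2 ⟨hy, hy'⟩)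

variable {V : Type*} [Fintype V] {G : SimpleGraph V} [DecidableRel G.Adj] {h k : ℕ}
  {a : Fin k → ℕ} {b : ℕ}

/-- Of the `2h + 1` indices at most one is unused, so one end of the path has a full block of
neighbours and the other misses at most one. -/
lemma forest_isContained_of_no_cycle (hk : 1 ≤ k) (ha : ∀ i, 1 ≤ a i) (hb : 1 ≤ b)
    (hh : h + 1 = (∑ i, a i) + b) (hh1 : 1 ≤ h) (hG : G.Connected) (hδ : h ≤ G.minDegree)
    (hmax : ∀ q g, PathSeq G q g → q ≤ 2 * h + 2) (hV : 2 * h + 2 < Fintype.card V)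
    {f : ℕ → V} (hf : PathSeq G (2 * h + 2) f)
    (hgap : ∀ i ∈ lastNbrs G (2 * h + 2) f, ∀ d, d ≤ 2 → i + d ∉ headNbrs G (2 * h + 2) f) :
    forest a b ⊑ G := by
  have hA := hδ.trans (hf.minDegree_le_card_headNbrs hmax)
  have hB := hδ.trans (hf.minDegree_le_card_lastNbrs (by omega) hmax)
  have hlt := lt_of_no_short_gap 1 headNbrs_subset lastNbrs_subset hA hB
    (Finset.disjoint_right.2 fun i hi => by simpa using hgap i hi 0 (by omega)) (by omega) hgap
  obtain ⟨m, hm1, hm2, hm3, hm4⟩ := exists_threshold hh1 headNbrs_subset lastNbrs_subset hA hB hlt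
  have mem_last : ∀ i, h ≤ i → i ≤ 2 * h → ¬ G.Adj (f (2 * h + 1)) (f i) →
      i + 1 ∉ lastNbrs G (2 * h + 2) f := fun i _ _ hi hi' => hi (mem_lastNbrs.1 hi').2
  obtain rfl | rfl : m = h ∨ m = h + 1 := by omega
  · have eA := Finset.eq_of_subset_of_card_le hm3 (by simpa using hA)
    refine forest_isContained_of_longest_even hk ha hb hh hh1 hG hδ hmax hV hf ?_ ?_
    · intro i h1 h2
      exact (mem_headNbrs.1 (eA ▸ Finset.mem_Icc.2 ⟨h1, h2⟩)).2
    · intro i j hi hi' hj hj' hni hnj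
      have := eq_of_mem_sdiff_of_card_le hm4 (by rw [Nat.card_Ico]; omega)
        (Finset.mem_Ico.2 (by omega)) (mem_last i hi hi' hni) (Finset.mem_Ico.2 (by omega))
        (mem_last j hj hj' hnj)
      omega
  · have eB := Finset.eq_of_subset_of_card_le hm4 (by rw [Nat.card_Ico]; omega)
    -- Here the last vertex has the full block, so the path is reversed.
    refine forest_isContained_of_longest_even hk ha hb hh hh1 hG hδ hmax hV hf.rev ?_ ?_
    · intro i h1 h2
      have h3 : 2 * h + 2 - i ∈ lastNbrs G (2 * h + 2) f :=
        eB ▸ Finset.mem_Ico.2 (by omega)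
      have := (mem_lastNbrs.1 h3).2
      rw [show 2 * h + 2 - i - 1 = 2 * h + 2 - 1 - i by omega] at this
      exact this
    · intro i j hi hi' hj hj' hni hnj
      have mem_head : ∀ i, h ≤ i → i ≤ 2 * h →
          ¬ G.Adj (f (2 * h + 2 - 1 - (2 * h + 1))) (f (2 * h + 2 - 1 - i)) →
          2 * h + 2 - 1 - i ∉ headNbrs G (2 * h + 2) f := by
        intro i _ _ hi hi'
        apply hi
        rw [show 2 * h + 2 - 1 - (2 * h + 1) = 0 by omega]
        exact (mem_headNbrs.1 hi').2
      have := eq_of_mem_sdiff_of_card_le hm3 (by rw [Nat.card_Icc]; omega)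
        (Finset.mem_Icc.2 (by omega)) (mem_head i hi hi' hni) (Finset.mem_Icc.2 (by omega))
        (mem_head j hj hj' hnj)
      omega

theorem forest_isContained_or (G : SimpleGraph V) [DecidableRel G.Adj]
    (hk : 1 ≤ k) (ha : ∀ i, 1 ≤ a i) (hb : 1 ≤ b) (hh : h + 1 = (∑ i, a i) + b) (hh1 : 1 ≤ h)
    {n : ℕ} (hn : Fintype.card V = n) (hn' : 2 * h + 3 ≤ n) (hconn : G.Connected)
    (hδ : h ≤ G.minDegree) :
    forest a b ⊑ G ∨ G ⊑ S n h ∨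
      (Nonempty (forest a b ≃g (pathGraph 6 ⊕g pathGraph 3)) ∧ Even n ∧
        G ⊑ join (K 2) (copies ((n - 2) / 2) (K 2))) ∨
      ((Nonempty (forest a b ≃g (pathGraph (2 * b) ⊕g pathGraph (2 * b + 1))) ∨
          Nonempty (forest a b ≃g (pathGraph (2 * b + 2) ⊕g pathGraph (2 * b + 1)))) ∧
        ∃ t : ℕ, n = t * h + 1 ∧ Nonempty (G ≃g L t h)) := by
  have := hconn.nonempty
  obtain ⟨p, f, hf, hmax⟩ := exists_longest_pathSeq G
  by_cases hp : 2 * h + 3 ≤ p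
  · exact Or.inl (forest_isContained_of_path hh hf hp)
  have hp0 : 0 < p := hmax 1 _ (pathSeq_one hconn.nonempty.some)
  have chord : ∀ i ∈ lastNbrs G p f, ∀ d, i + d ∈ headNbrs G p f → ∀ m, m + d = p →
      ∃ c : ZMod m → V, CycleSeq G m c ∧ (∀ s, ∃ t < p, (t < i ∨ i + d ≤ t) ∧ c s = f t) ∧
        ∀ t < p, t < i ∨ i + d ≤ t → ∃ s, c s = f t := by
    intro i hi d hid m hm
    rw [mem_lastNbrs] at hi
    rw [mem_headNbrs] at hid
    exact hf.exists_cycleSeq hi.1.1 (by omega) hid.1.2 hi.2 hid.2 (by omega)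
  have chord0 : ∀ i ∈ lastNbrs G p f, i ∉ headNbrs G p f := by
    intro i hi hi'
    obtain ⟨c, hc, -⟩ := chord i hi 0 hi' p rfl
    have : NeZero p := ⟨by omega⟩
    obtain ⟨g, hg⟩ := hc.exists_longer hconn (by omega)
    have := hmax _ _ hg
    omega
  have hp1 : 2 * h + 1 ≤ p := by
    have h1 := Finset.card_le_card
      (Finset.union_subset (headNbrs_subset (G := G) (p := p) (f := f)) (lastNbrs_subset (G := G) (f := f)))
    rw [Finset.card_union_of_disjoint (Finset.disjoint_right.2 chord0), Nat.card_Ico] at h1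
    have := hf.minDegree_le_card_headNbrs hmax
    have := hf.minDegree_le_card_lastNbrs hp0 hmax
    omega
  obtain rfl | rfl : p = 2 * h + 1 ∨ p = 2 * h + 2 := by omega
  · by_cases hcyc : ∃ c : ZMod (2 * h) → V, CycleSeq G (2 * h) c
    · obtain ⟨c, hc⟩ := hcyc
      exact Or.inr (Or.inl (isContained_S_of_cycle hn hh1 hn' hconn hδ hmax hc))
    · push Not at hcyc
      obtain ⟨⟨t, ht, e⟩, g, hg, hgf⟩ :=
        iso_L_of_longest_odd hh1 hconn hδ hmax (by omega) hcyc hf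
      rcases exists_order_le_or (b := b) ha hk hh1 hh with ⟨i, hi⟩ | ⟨hk1, hab⟩
      · refine Or.inl (forest_isContained_of_order_le (m := 2) hh hg hf hgf i hi ?_ (by omega))
        cases i with
        | none => simp only [orders]; omega
        | some i => have := ha i; simp only [orders]; omega
      · refine Or.inr (Or.inr (Or.inr ⟨?_, t, by omega, e⟩))
        have all : ∀ i, a i = a ⟨0, hk⟩ := fun i => by
          congr 1
          ext
          dsimp only
          omega
        rcases hab ⟨0, hk⟩ with h0 | h0
        · exact Or.inl (nonempty_forest_iso hk1 fun i => (all i).trans h0)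
        · exact Or.inr (nonempty_forest_iso (m := b + 1) hk1 fun i => (all i).trans h0)
  · by_cases hcyc : ∃ c : ZMod (2 * h + 1) → V, CycleSeq G (2 * h + 1) c
    · obtain ⟨c, hc⟩ := hcyc
      exact Or.inl (forest_isContained_of_cycle hk ha hb hh hh1 (by omega) hconn hδ hmax hc)
    push Not at hcyc
    by_cases hgap : ∃ i ∈ lastNbrs G (2 * h + 2) f, i + 2 ∈ headNbrs G (2 * h + 2) f
    · obtain ⟨i, hi, hi2⟩ := hgap
      -- For `h = 1` the only possible index is `i = 1`, which already lies in `headNbrs` because of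
      -- the first edge of the path.
      have hh2 : 2 ≤ h := by
        by_contra hh2
        obtain rfl : h = 1 := by omega
        have h1 := mem_lastNbrs.1 hi
        have h2 := mem_headNbrs.1 hi2
        obtain rfl : i = 1 := by omega
        exact chord0 1 hi (mem_headNbrs.2 ⟨by omega, hf.adj (i := 0) (by omega)⟩)
      obtain ⟨c, hc, hc1, hc2⟩ := chord i hi 2 hi2 (2 * h) (by omega)
      have h1 := mem_lastNbrs.1 hi
      have h2 := mem_headNbrs.1 hi2
      have out : ∀ j, i ≤ j → j < i + 2 → ∀ s, f j ≠ c s := by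
        intro j hj hj' s hs
        obtain ⟨t, ht, ht', hst⟩ := hc1 s
        have := hf.inj (by omega) ht (hs.trans hst)
        omega
      have hu := out i le_rfl (by omega)
      have hw := out (i + 1) (by omega) (by omega)
      have huw : G.Adj (f i) (f (i + 1)) := hf.adj (by omega)
      obtain ⟨s, hs⟩ := hc2 (i - 1) (by omega) (Or.inl (by omega))
      obtain ⟨s', hs'⟩ := hc2 (i + 2) (by omega) (Or.inr le_rfl)
      have hus : G.Adj (f i) (c s) := hs ▸ hf.adj_of (by omega) (by omega) (by omega)
      have hws : G.Adj (f (i + 1)) (c s') := hs' ▸ hf.adj_of (by omega) (by omega) (by omega)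
      rcases adj_of_outside_edge hconn hδ hh2 hmax (by omega) hcyc hc hu hw huw hus with
        ⟨-, h3⟩ | ⟨rfl, -⟩
      -- The case `h = 2` would make both ends of the missed edge attach to the same cycle vertex,
      -- but they attach to `f (i - 1)` and `f (i + 2)`.
      · have h4 := h3 _ hws
        rw [h4, hs] at hs'
        have := hf.inj (by omega) (by omega) hs'
        omega
      · refine (forest_isContained_or_of_six_cycle hn hk ha hb hh hconn hδ hmax (by omega) hcyc hc
          hu hw huw hus).imp_right fun h5 => Or.inr (Or.inl h5)
    · push Not at hgap
      refine Or.inl (forest_isContained_of_no_cycle hk ha hb hh hh1 hconn hδ hmax (by omega) hf ?_)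
      intro i hi d hd hid
      obtain rfl | rfl | rfl : d = 0 ∨ d = 1 ∨ d = 2 := by omega
      · exact chord0 i hi hid
      · obtain ⟨c, hc, -⟩ := chord i hi 1 hid (2 * h + 1) (by omega)
        exact hcyc c hc
      · exact hgap i hi hid

end Main

end PathForest

theorem theorem2 {V : Type*} [Fintype V] (G : SimpleGraph V) [DecidableRel G.Adj]
    (k : ℕ) (hk : 1 ≤ k) (a : Fin k → ℕ) (ha : ∀ i, 1 ≤ a i) (b : ℕ) (hb : 1 ≤ b)
    (h : ℕ) (hh : h + 1 = (∑ i, a i) + b) (hh1 : 1 ≤ h)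
    (n : ℕ) (hn : Fintype.card V = n) (hn' : 2 * h + 3 ≤ n)
    (hconn : G.Connected) (hδ : h ≤ G.minDegree) :
    PathForest.forest a b ⊑ G ∨
      G ⊑ PathForest.S n h ∨
      (Nonempty (PathForest.forest a b ≃g (pathGraph 6 ⊕g pathGraph 3)) ∧ Even n ∧
        G ⊑ PathForest.join (PathForest.K 2)
          (PathForest.copies ((n - 2) / 2) (PathForest.K 2))) ∨
      ((Nonempty (PathForest.forest a b ≃g (pathGraph (2 * b) ⊕g pathGraph (2 * b + 1))) ∨
          Nonempty (PathForest.forest a b ≃g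
            (pathGraph (2 * b + 2) ⊕g pathGraph (2 * b + 1)))) ∧
        ∃ t : ℕ, n = t * h + 1 ∧ Nonempty (G ≃g PathForest.L t h)) :=
  PathForest.forest_isContained_or G hk ha hb hh hh1 hn hn' hconn hδ
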